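/- **Setting.** Let $f:U'\to U$ be a Douady–Hubbard quadratic-like map: $U',U\subset\mathbb C$ are topological disks, $\overline{U'}$ is a compact subset of $U$, and $f$ is a holomorphic double branched covering with its only critical point at $0$. Assume that its Julia set $J(f)=\partial K(f)$, where $K(f)=\{z: f^nz\in U',\ n\ge 0\}$, is connected and that all fixed points of $f$ are repelling. Fix a topological conjugacy $h$ between $f$ near $K(f)$ and a quadratic polynomial $z\mapsto z^2+c$ near its filled Julia set, and transfer the external rays and equipotentials of the polynomial to $f$ by $h$. Let $\alpha$ be the dividing fixed point of $f$, that is, the one at which at least two rays land, let $p$ be the number of these rays, and let $E$ be an equipotential so close to $K(f)$ that $E$ and $f(E)$ are closed curves in the domain of $h$. **Puzzle.** The *puzzle pieces of depth $0$* are the closures of the components into which the rays landing at $\alpha$ (together with $\alpha$) cut the domain bounded by $E$. The *pieces of depth $n$* are the closures of the connected components of $f^{-n}(\operatorname{int}Y)$, $Y$ a piece of depth $0$. If $f^l z\in\operatorname{int}W$, the *pull-back* of $W$ along $z,fz,\dots,f^lz$ is the chain $W_0=W,W_{-1},\dots,W_{-l}$, where $W_{-k}$ is the closure of the component of $f^{-1}(\operatorname{int}W_{-k+1})$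 containing $f^{l-k}z$; its last set $W_{-l}\ni z$ is also called the pull-back. **Principal nest.** Let $\alpha'\ne\alpha$ be the other preimage of $\alpha$, and let $Z_i$ be the pieces of depth $1$ that contain $\alpha'$ but do not have $0$ in their interior. Assume that $f^{tp}(0)\in\operatorname{int}Z_\nu$ for some $t$ and $\nu$, and let $t$ be the smallest such number. Let $V^0\ni 0$ be the pull-back of $Z_\nu$ along $0,f(0),\dots,f^{tp}(0)$. As long as $0$ returns to $\operatorname{int}V^n$, with first return time $l(n+1)>0$, let $V^{n+1}$ be the pull-back of $V^n$ along $0,\dots,f^{l(n+1)}(0)$, and let $g_{n+1}=f^{l(n+1)}:V^{n+1}\to V^n$. The return to level $n$ is *central* if $g_{n+1}(0)\in V^{n+1}$. **Lemma 3.7.** Let $m\ge 0$ and $N\ge 1$ be such that $V^m\supset V^{m+1}\supset\dots\supset V^{m+N}$ exist and form a central cascade: the returns to the levels $m,\dots,m+N-2$ are central and the return to level $m+N-1$ is not (so $g_{m+1}(0)\in V^{m+N-1}\setminus V^{m+N}$). Let $z$ be a point whose orbit passes through $\operatorname{int}V^{m+N}$, and let $l\ge 0$ be the first moment for which $f^lz\in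 V^{m+N}$. Then there is a puzzle piece $\Omega\ni z$ which is mapped univalently by $f^l$ onto $V^m$: the iterates $f,\dots,f^l$ are defined on $\Omega$, $f^l:\Omega\to V^m$ is bijective, and $f^l$ restricts to a conformal isomorphism $\operatorname{int}\Omega\to\operatorname{int}V^m$. -/

import Mathlib

open Set Filter Topology

/-- A topological disk: a simply connected region of the plane. -/
def IsTopologicalDisk (U : Set ℂ) : Prop := IsOpen U ∧ IsSimplyConnected U

/-- A Douady-Hubbard quadratic-like map `f : dom → ran`, normalized to have its critical point
at `0`. The values of `f` outside `dom` play no role. The fields `proper`, `fiber` and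
`fiber_crit` say that the holomorphic map `f : dom → ran` is a branched covering of degree two
whose only branch point is `0`. -/
structure QuadraticLikeMap where
  f : ℂ → ℂ
  dom : Set ℂ
  ran : Set ℂ
  disk_dom : IsTopologicalDisk dom
  disk_ran : IsTopologicalDisk ran
  compact_closure : IsCompact (closure dom)
  closure_subset : closure dom ⊆ ran
  holo : DifferentiableOn ℂ f dom
  mapsTo : MapsTo f dom ran
  proper : ∀ K ⊆ ran, IsCompact K → IsCompact (dom ∩ f ⁻¹' K)
  zero_mem : (0 : ℂ) ∈ dom
  fiber : ∀ w ∈ ran, w ≠ f 0 → (dom ∩ f ⁻¹' {w}).ncard = 2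
  fiber_crit : dom ∩ f ⁻¹' {f 0} = {0}

namespace QuadraticLikeMap

/-- The points `z` for which `f z, …, f^n z` are defined and `f^n z ∈ S`. -/
def iterPreimage (F : QuadraticLikeMap) (n : ℕ) (S : Set ℂ) : Set ℂ :=
  {z | (∀ k < n, F.f^[k] z ∈ F.dom) ∧ F.f^[n] z ∈ S}

/-- The filled Julia set: the set of non-escaping points. -/
def filledJulia (F : QuadraticLikeMap) : Set ℂ := {z | ∀ n, F.f^[n] z ∈ F.dom}

/-- The Julia set. -/
def juliaSet (F : QuadraticLikeMap) : Set ℂ := frontier F.filledJulia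

/-- All fixed points of `f` are repelling. -/
def FixedPointsRepelling (F : QuadraticLikeMap) : Prop :=
  ∀ a ∈ F.dom, F.f a = a → 1 < ‖deriv F.f a‖

/-- The last set `W_{-l} ∋ z` of the pull-back `W_0 = W, W_{-1}, …, W_{-l}` of `W` along
`z, f z, …, f^l z`: each `W_{-k}` is the closure of the component of
`f⁻¹ (int W_{-k+1})` containing `f^{l-k} z`. -/
def pullback (F : QuadraticLikeMap) (W : Set ℂ) : ℕ → ℂ → Set ℂ
  | 0, _ => W
  | l + 1, z =>
      closure (connectedComponentIn (F.dom ∩ F.f ⁻¹' interior (F.pullback W l (F.f z))) z)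

/-- The critical point `0` returns to `int W`. -/
def CriticalReturns (F : QuadraticLikeMap) (W : Set ℂ) : Prop :=
  ∃ k, 0 < k ∧ F.f^[k] 0 ∈ interior W

/-- The first return time of the critical point `0` to `int W` (if there is one). -/
noncomputable def returnTime (F : QuadraticLikeMap) (W : Set ℂ) : ℕ :=
  sInf {k | 0 < k ∧ F.f^[k] 0 ∈ interior W}

/-- The pieces `V^0, V^1, …` generated by `V^0 = W`: `V^{n+1}` is the pull-back of `V^n`
corresponding to the first return of the critical point to `int V^n`. It is meaningful up to
level `n` as long as the critical point returns to `int V^0, …, int V^{n-1}`. -/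
noncomputable def nest (F : QuadraticLikeMap) (W : Set ℂ) : ℕ → Set ℂ
  | 0 => W
  | n + 1 => F.pullback (F.nest W n) (F.returnTime (F.nest W n)) 0

/-- The value `g_{n+1}(0)` of the return map `V^{n+1} → V^n` at the critical point. -/
noncomputable def returnValue (F : QuadraticLikeMap) (W : Set ℂ) (n : ℕ) : ℂ :=
  F.f^[F.returnTime (F.nest W n)] 0

/-- The pieces `V^m ⊃ ⋯ ⊃ V^{m+N}` of the nest exist, and the levels `m, …, m+N-1` form a central
cascade: the return to level `n` is central (that is, `g_{n+1}(0) ∈ V^{n+1}`) for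
`n = m, …, m+N-2`, and the return to level `m+N-1` is not. -/
def IsCentralCascade (F : QuadraticLikeMap) (W : Set ℂ) (m N : ℕ) : Prop :=
  1 ≤ N ∧
  (∀ n < m + N, F.CriticalReturns (F.nest W n)) ∧
  (∀ n, m ≤ n → n + 1 < m + N → F.returnValue W n ∈ F.nest W (n + 1)) ∧
  ∀ n, n + 1 = m + N → F.returnValue W n ∉ F.nest W (n + 1)

/-- `f^l` is defined on `Ω` and maps the closed piece `Ω` univalently onto the closed piece `V`:
it is a bijection `Ω → V`, and restricts to a conformal isomorphism `int Ω → int V`. -/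
def MapsUnivalently (F : QuadraticLikeMap) (l : ℕ) (Ω V : Set ℂ) : Prop :=
  (∀ k < l, MapsTo F.f^[k] Ω F.dom) ∧
  BijOn F.f^[l] Ω V ∧
  BijOn F.f^[l] (interior Ω) (interior V) ∧
  DifferentiableOn ℂ F.f^[l] (interior Ω)

end QuadraticLikeMap

/-- The basin of infinity of `z ↦ z ^ 2 + c`. -/
def quadBasin (c : ℂ) : Set ℂ :=
  {z | Tendsto (fun n : ℕ => ‖(fun w : ℂ => w ^ 2 + c)^[n] z‖) atTop atTop}

/-- `B` is the Böttcher function of `z ↦ z ^ 2 + c`, when this polynomial has connected Julia set: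
the conformal map of the whole basin of infinity onto `{|w| > 1}` that conjugates the polynomial
to `w ↦ w ^ 2` and is asymptotic to the identity at infinity. -/
def IsBottcher (c : ℂ) (B : ℂ → ℂ) : Prop :=
  DifferentiableOn ℂ B (quadBasin c) ∧
  BijOn B (quadBasin c) {w | 1 < ‖w‖} ∧
  (∀ z ∈ quadBasin c, B (z ^ 2 + c) = B z ^ 2) ∧
  Tendsto (fun z => B z / z) (cocompact ℂ) (𝓝 1)

open Classical in
/-- The Böttcher function on the basin of infinity (zero if the Julia set is disconnected, so that
then no ray exists). -/
noncomputable def bottcher (c : ℂ) : ℂ → ℂ :=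
  if h : ∃ B, IsBottcher c B then h.choose else 0

/-- The external ray of `z ↦ z ^ 2 + c` with angle `arg u`. -/
def externalRay (c : ℂ) (u : Circle) : Set ℂ :=
  {z | z ∈ quadBasin c ∧ ∃ r : ℝ, 1 < r ∧ bottcher c z = r * u}

/-- The external ray with angle `arg u` lands at `a`. -/
def RayLandsAt (c : ℂ) (u : Circle) (a : ℂ) : Prop :=
  ∃ γ : ℝ → ℂ, (∀ r, 1 < r → γ r ∈ quadBasin c ∧ bottcher c (γ r) = r * u) ∧
    Tendsto γ (𝓝[>] 1) (𝓝 a)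

/-- The (angles of the) external rays of `z ↦ z ^ 2 + c` landing at `a`. -/
def landingAngles (c a : ℂ) : Set Circle := {u | RayLandsAt c u a}

/-- The data defining the Yoccoz puzzle of a quadratic-like map `F`: a topological conjugacy `h`
from a neighborhood of the filled Julia set of `F` to a neighborhood of the filled Julia set of a
quadratic polynomial `z ↦ z ^ 2 + c`, by which rays and equipotentials are transferred to `F`;
the dividing fixed point `α`; and the level `η` of an equipotential `E` which is so close to the
filled Julia set that both `E` and `f E` are closed curves in the domain of `h`. -/
structure YoccozPuzzle (F : QuadraticLikeMap) where
  c : ℂ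
  h : OpenPartialHomeomorph ℂ ℂ
  filledJulia_subset : F.filledJulia ⊆ h.source
  source_subset : h.source ⊆ F.dom
  target_supset : (quadBasin c)ᶜ ⊆ h.target
  conj : ∀ z ∈ h.source, F.f z ∈ h.source → h (F.f z) = h z ^ 2 + c
  α : ℂ
  α_mem : α ∈ F.dom
  α_fixed : F.f α = α
  /-- At least two rays land at `α`. -/
  dividing : (landingAngles c (h α)).Nontrivial
  η : ℝ
  η_pos : 0 < η
  η_small : {w | w ∈ quadBasin c → ‖bottcher c w‖ ≤ Real.exp (2 * η)} ⊆ h.target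

namespace YoccozPuzzle

variable {F : QuadraticLikeMap}

/-- The number of rays landing at `α` (which are finitely many). They are permuted cyclically by `f`, so this is also the
denominator of the combinatorial rotation number `q/p` of `α`. -/
noncomputable def p (P : YoccozPuzzle F) : ℕ := (landingAngles P.c (P.h P.α)).ncard

/-- The union of the external rays of `F` landing at `α`, together with `α`. -/
def rays (P : YoccozPuzzle F) : Set ℂ :=
  {z | z ∈ P.h.source ∧ ∃ u ∈ landingAngles P.c (P.h P.α), P.h z ∈ externalRay P.c u} ∪ {P.α}

/-- The (open) domain bounded by the equipotential `E`. -/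
def equipotentialDomain (P : YoccozPuzzle F) : Set ℂ :=
  {z | z ∈ P.h.source ∧ (P.h z ∈ quadBasin P.c → ‖bottcher P.c (P.h z)‖ < Real.exp P.η)}

/-- `Y` is a (closed) puzzle piece of depth zero. -/
def IsPieceZero (P : YoccozPuzzle F) (Y : Set ℂ) : Prop :=
  ∃ z ∈ P.equipotentialDomain \ P.rays,
    Y = closure (connectedComponentIn (P.equipotentialDomain \ P.rays) z)

/-- `Q` is a (closed) puzzle piece of depth `n`: the closure of a connected component of
`f^{-n} (int Y)`, where `Y` is a puzzle piece of depth zero. -/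
def IsPiece (P : YoccozPuzzle F) (n : ℕ) (Q : Set ℂ) : Prop :=
  ∃ Y, P.IsPieceZero Y ∧ ∃ z ∈ F.iterPreimage n (interior Y),
    Q = closure (connectedComponentIn (F.iterPreimage n (interior Y)) z)

/-- `Z` is one of the non-critical pieces `Z_i^{(1)}` of depth one attached to the point
`α' ≠ α` with `f α' = α`. -/
def IsZPiece (P : YoccozPuzzle F) (Z : Set ℂ) : Prop :=
  P.IsPiece 1 Z ∧ 0 ∉ interior Z ∧ ∃ a ∈ F.dom, a ≠ P.α ∧ F.f a = P.α ∧ a ∈ Z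

/-- The critical point escapes through the pieces `Z_i^{(1)}`: `t` is the first moment for which
`f^{tp}(0)` belongs to one of them, and `Z` is this piece. -/
def EscapesThrough (P : YoccozPuzzle F) (t : ℕ) (Z : Set ℂ) : Prop :=
  P.IsZPiece Z ∧ F.f^[t * P.p] 0 ∈ interior Z ∧
    ∀ s < t, ∀ Z', P.IsZPiece Z' → F.f^[s * P.p] 0 ∉ interior Z'

/-- The piece `V^n` of the principal nest: `V^0` is the pull-back of `Z` along
`0, f 0, …, f^{tp} 0`. -/
noncomputable def principalNest (P : YoccozPuzzle F) (t : ℕ) (Z : Set ℂ) : ℕ → Set ℂ :=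
  F.nest (F.pullback Z (t * P.p) 0)

/-- The pieces `V^m ⊃ ⋯ ⊃ V^{m+N}` of the principal nest exist and form a central cascade. -/
def IsCentralCascade (P : YoccozPuzzle F) (t : ℕ) (Z : Set ℂ) (m N : ℕ) : Prop :=
  F.IsCentralCascade (F.pullback Z (t * P.p) 0) m N

end YoccozPuzzle

/-! Pull $V^m$ back along $z,\dots,f^lz$. The pull-back is univalent unless one of its intermediate
pieces, say the one around $x=f^jz$ with $j<l$, contains the critical point $0$. Let $d$ be the
depth of $V^m$ and $r$ the first return time of $0$ to it. Centrality makes the critical returns to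
all levels of the cascade happen at this same time $r$, so $V^{m+i}$ is the piece of depth $d+ir$
around $0$ for $i\le N$ (`exists_cascade`).

Put $k=l-j$. A critical intermediate piece means that $x$ lies in the piece of depth $d+k$ around
$0$, while $f^kx\in V^{m+N}$. This forces $x\in V^{m+N}$, against the minimality of $l$. For $k\ge
Nr$ it is the nesting of pieces. The case $0<k<r$ cannot occur, since $0$ would return to $V^m$ at
time $k$. For $r\le k\le Nr$ the point $f^rx$ is in the same situation with $k-r$; by induction it
lies in $V^{m+N}\subset V^{m+N-1}$, and the preimage of $V^{m+N-1}$ in $V^{m+1}$ under $f^r$ is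
$V^{m+N}$ (`cascade_pullback`, `cascade_mem`).

The puzzle is studied for the polynomial and carried to $f$ by the conjugacy. Two facts need plane
topology, obtained here from square roots. Open pieces are the interiors of closed ones
(`interior_closure_piece`), so the alternation of closures and interiors in a pull-back is harmless:
otherwise $w-a$ would have a continuous square root on a circle around the fixed point $a$. The
polynomial is injective on closed noncritical pieces (`injOn_closure_piece`), because $w-c$ has a
square root on the image. The transfer rests on the conjugacy holding on the whole equipotential
domain (`f_symm`), on its fixing $0$ (`symm_zero`), and on counting fibers of degree two
(`preimage_image_symm`). -/

/-! ### Square roots, open maps and components -/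

/-- If `v` can be joined to a point `b` far away in the complement of `S`, then `w - v` has a
continuous square root on `S`. -/
theorem exists_sqrt_of_joinedIn {S : Set ℂ} {v b : ℂ} (hS : ∀ w ∈ S, ‖w‖ < ‖b‖)
    (h : JoinedIn Sᶜ v b) :
    ∃ s : ℂ → ℂ, ContinuousOn s S ∧ ∀ w ∈ S, s w ^ 2 = w - v := by
  classical
  by_cases hne : S.Nonempty
  swap
  · rw [not_nonempty_iff_eq_empty] at hne
    subst hne
    exact ⟨fun _ => 0, by simp, by simp⟩
  have hb : b ≠ 0 := by
    rintro rfl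
    obtain ⟨w, hw⟩ := hne
    have := hS w hw
    rw [norm_zero] at this
    exact absurd this (not_lt.mpr (norm_nonneg w))
  set γ := h.somePath
  have hγ : ∀ t, γ t ∈ Sᶜ := fun t => h.somePath_mem t
  -- This homotopy runs from $w-b$ to $w-v$ and never vanishes on $S$, so a logarithm can be lifted
  -- along it through the covering $\exp$.
  let H : C(unitInterval × S, {z : ℂ // z ≠ 0}) :=
    ⟨fun q => ⟨(q.2 : ℂ) - γ (unitInterval.symm q.1), by
      intro h0
      apply hγ (unitInterval.symm q.1)
      rw [sub_eq_zero] at h0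
      rw [← h0]; exact q.2.2⟩, by fun_prop⟩
  have hslit : ∀ w : S, 1 - (w : ℂ) / b ∈ Complex.slitPlane := by
    intro w
    rw [sub_eq_add_neg]
    apply Complex.mem_slitPlane_of_norm_lt_one
    rw [norm_neg, norm_div, div_lt_one (norm_pos_iff.mpr hb)]
    exact hS w w.2
  -- The initial logarithm comes from $w-b=(-b)(1-w/b)$, whose second factor avoids the slit because
  -- $|w|<|b|$.
  let g : C(S, ℂ) := ⟨fun w => Complex.log (-b) + Complex.log (1 - (w : ℂ) / b), by
    apply continuous_const.add
    apply Continuous.clog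
    · fun_prop
    · exact hslit⟩
  have H0 : ∀ w : S, H (0, w) = ⟨Complex.exp (g w), Complex.exp_ne_zero _⟩ := by
    intro w
    apply Subtype.ext
    simp only [H, g, ContinuousMap.coe_mk, unitInterval.symm_zero, Path.target]
    rw [Complex.exp_add, Complex.exp_log (neg_ne_zero.mpr hb),
      Complex.exp_log (Complex.slitPlane_ne_zero (hslit w))]
    field_simp
    ring
  let L := Complex.isCoveringMap_exp.liftHomotopy H g H0
  have hL : ∀ w : S, Complex.exp (L (1, w)) = w - v := by
    intro w
    have := congrFun (Complex.isCoveringMap_exp.liftHomotopy_lifts H g H0) (1, w)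
    have h1 : Complex.exp (L (1, w)) = (H (1, w) : ℂ) := congrArg Subtype.val this
    rw [h1]
    simp [H]
  refine ⟨fun w => if hw : w ∈ S then Complex.exp (L (1, ⟨w, hw⟩) / 2) else 0, ?_, ?_⟩
  · rw [continuousOn_iff_continuous_domRestrict]
    have : S.domRestrict (fun w => if hw : w ∈ S then Complex.exp (L (1, ⟨w, hw⟩) / 2) else 0) =
        fun w : S => Complex.exp (L (1, w) / 2) := by
      funext w
      simp [Set.domRestrict]
    rw [this]
    fun_prop
  · intro w hw
    simp only [hw, dif_pos]
    rw [← Complex.exp_nat_mul, ← hL ⟨w, hw⟩]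
    congr 1
    push_cast
    ring

/-- There is no continuous square root of `w - a` on a circle around `a`. -/
theorem not_continuousOn_sqrt_sphere {a : ℂ} {ρ : ℝ} (hρ : 0 < ρ) {s : ℂ → ℂ}
    (hs : ContinuousOn s (Metric.sphere a ρ)) (h : ∀ w ∈ Metric.sphere a ρ, s w ^ 2 = w - a) :
    False := by
  have hmem : ∀ θ : ℝ, a + ρ * Complex.exp (θ * Complex.I) ∈ Metric.sphere a ρ := by
    intro θ
    simp [Complex.norm_exp_ofReal_mul_I, abs_of_pos hρ]
  have hρ' : ((Real.sqrt ρ : ℝ) : ℂ) ^ 2 = ρ := by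
    rw [← Complex.ofReal_pow, Real.sq_sqrt hρ.le]
  have hρ0 : ((Real.sqrt ρ : ℝ) : ℂ) ≠ 0 := by
    exact_mod_cast (Real.sqrt_pos.mpr hρ).ne'
  have hf : Continuous fun θ : ℝ => s (a + ρ * Complex.exp (θ * Complex.I)) := by
    apply hs.comp_continuous (by fun_prop) hmem
  have hg : Continuous fun θ : ℝ => (Real.sqrt ρ : ℂ) * Complex.exp (θ / 2 * Complex.I) := by
    fun_prop
  have hsq : EqOn ((fun θ : ℝ => s (a + ρ * Complex.exp (θ * Complex.I))) ^ 2)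
      ((fun θ : ℝ => (Real.sqrt ρ : ℂ) * Complex.exp (θ / 2 * Complex.I)) ^ 2) univ := by
    intro θ _
    simp only [Pi.pow_apply]
    rw [h _ (hmem θ), mul_pow, hρ', ← Complex.exp_nat_mul, add_sub_cancel_left]
    congr 2
    push_cast
    ring
  have hexp : Complex.exp (2 * Real.pi / 2 * Complex.I) = -1 := by
    rw [mul_div_cancel_left₀ _ (two_ne_zero), Complex.exp_pi_mul_I]
  -- Along the circle the root is $\pm\sqrt\rho\,e^{i\theta/2}$ with a constant sign; the angles $0$
  -- and $2\pi$ are one point but give opposite values.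
  rcases isPreconnected_univ.eq_or_eq_neg_of_sq_eq hf.continuousOn hg.continuousOn hsq
    (fun {θ} _ => mul_ne_zero hρ0 (Complex.exp_ne_zero _)) with h1 | h1
  · have e0 := h1 (mem_univ (0 : ℝ))
    have e1 := h1 (mem_univ (2 * Real.pi : ℝ))
    simp only [Complex.ofReal_zero, zero_mul, Complex.exp_zero, zero_div, Complex.ofReal_mul,
      Complex.ofReal_ofNat, Complex.exp_two_pi_mul_I, hexp] at e0 e1
    rw [e0] at e1
    apply hρ0
    linear_combination e1 / 2
  · have e0 := h1 (mem_univ (0 : ℝ))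
    have e1 := h1 (mem_univ (2 * Real.pi : ℝ))
    simp only [Pi.neg_apply, Complex.ofReal_zero, zero_mul, Complex.exp_zero, zero_div, Complex.ofReal_mul,
      Complex.ofReal_ofNat, Complex.exp_two_pi_mul_I, hexp] at e0 e1
    rw [e0] at e1
    apply hρ0
    linear_combination -e1 / 2

/-- A holomorphic function is open at a point whose fiber is finite. -/
theorem nhds_le_map_nhds_of_finite_fiber {f : ℂ → ℂ} {U : Set ℂ} {z : ℂ} (hU : IsOpen U) (hz : z ∈ U)
    (hf : DifferentiableOn ℂ f U) (hfin : (U ∩ f ⁻¹' {f z}).Finite) : 𝓝 (f z) ≤ map f (𝓝 z) := by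
  have han : AnalyticAt ℂ f z := hf.analyticAt (hU.mem_nhds hz)
  refine han.eventually_constant_or_nhds_le_map_nhds.resolve_left fun hconst => ?_
  have hmem : U ∩ f ⁻¹' {f z} ∈ 𝓝 z := by
    filter_upwards [hconst, hU.mem_nhds hz] with w hw hwU
    exact ⟨hwU, hw⟩
  exact (infinite_of_mem_nhds z hmem) hfin

/-- A component of an open set `G` is the interior of its closure if this interior lies in `G`. -/
theorem interior_closure_connectedComponentIn {X : Type*} [TopologicalSpace X]
    [LocallyConnectedSpace X] {G : Set X} (hG : IsOpen G) {x : X}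
    (h : interior (closure (connectedComponentIn G x)) ⊆ G) :
    interior (closure (connectedComponentIn G x)) = connectedComponentIn G x := by
  have hsub : connectedComponentIn G x ⊆ interior (closure (connectedComponentIn G x)) :=
    interior_maximal subset_closure hG.connectedComponentIn
  refine Subset.antisymm ?_ hsub
  by_cases hx : x ∈ G
  · exact (isPreconnected_connectedComponentIn.subset_closure hsub interior_subset).subset_connectedComponentIn
      (hsub (mem_connectedComponentIn hx)) h
  · simp [connectedComponentIn_eq_empty hx]

/-- Components of open sets are relatively closed. -/
theorem mem_connectedComponentIn_of_mem_closure {X : Type*} [TopologicalSpace X]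
    [LocallyConnectedSpace X] {G : Set X} (hG : IsOpen G) {x y : X} (hy : y ∈ G)
    (hc : y ∈ closure (connectedComponentIn G x)) : y ∈ connectedComponentIn G x := by
  obtain ⟨w, hw1, hw2⟩ := mem_closure_iff.mp hc _ hG.connectedComponentIn
    (mem_connectedComponentIn hy)
  rw [connectedComponentIn_eq hw2, ← connectedComponentIn_eq hw1]
  exact mem_connectedComponentIn hy

/-! ### The quadratic polynomial -/

/-- The quadratic polynomial `w ↦ w ^ 2 + c`. -/
def quad (c : ℂ) : ℂ → ℂ := fun w => w ^ 2 + c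

theorem quad_apply (c w : ℂ) : quad c w = w ^ 2 + c := rfl

theorem continuous_quad (c : ℂ) : Continuous (quad c) := by
  unfold quad; fun_prop

theorem continuous_quad_iterate (c : ℂ) (n : ℕ) : Continuous (quad c)^[n] :=
  (continuous_quad c).iterate n

theorem quad_neg (c w : ℂ) : quad c (-w) = quad c w := by simp [quad_apply]

theorem quad_eq_quad_iff {c x y : ℂ} : quad c x = quad c y ↔ x = y ∨ x = -y := by
  rw [quad_apply, quad_apply, add_left_inj, sq_eq_sq_iff_eq_or_eq_neg]

theorem exists_quad_eq (c y : ℂ) : ∃ x, quad c x = y := by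
  obtain ⟨x, hx⟩ := IsAlgClosed.exists_pow_nat_eq (y - c) (n := 2) (by norm_num)
  exact ⟨x, by rw [quad_apply, hx]; ring⟩

theorem finite_quad_preimage (c : ℂ) {S : Set ℂ} (hS : S.Finite) : (quad c ⁻¹' S).Finite := by
  refine hS.preimage' fun y _ => ?_
  obtain ⟨x, hx⟩ := exists_quad_eq c y
  refine (toFinite {x, -x}).subset fun w hw => ?_
  rw [mem_preimage, mem_singleton_iff, ← hx, quad_eq_quad_iff] at hw
  exact hw

theorem finite_quad_iterate_preimage (c : ℂ) {S : Set ℂ} (hS : S.Finite) (n : ℕ) :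
    ((quad c)^[n] ⁻¹' S).Finite := by
  induction n with
  | zero => exact hS
  | succ n ih =>
    rw [Function.iterate_succ, preimage_comp]
    exact finite_quad_preimage c ih

theorem nhds_le_map_quad (c w : ℂ) : 𝓝 (quad c w) ≤ map (quad c) (𝓝 w) := by
  apply nhds_le_map_nhds_of_finite_fiber isOpen_univ (mem_univ w)
  · unfold quad; fun_prop
  · exact (finite_quad_preimage c (finite_singleton _)).inter_of_right _

theorem isOpenMap_quad (c : ℂ) : IsOpenMap (quad c) :=
  IsOpenMap.of_nhds_le (nhds_le_map_quad c)

theorem isOpenMap_quad_iterate (c : ℂ) (n : ℕ) : IsOpenMap (quad c)^[n] := by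
  induction n with
  | zero => exact IsOpenMap.id
  | succ n ih =>
    rw [Function.iterate_succ]
    exact ih.comp (isOpenMap_quad c)

/-! ### The basin of infinity -/

section Basin

variable {c : ℂ}

theorem norm_quad_le (c w : ℂ) : ‖quad c w‖ ≤ ‖w‖ ^ 2 + ‖c‖ := by
  rw [quad_apply, ← norm_pow]
  exact norm_add_le _ _

theorem two_mul_norm_le_norm_quad {w : ℂ} (hw : ‖c‖ + 2 ≤ ‖w‖) : 2 * ‖w‖ ≤ ‖quad c w‖ := by
  have h1 : ‖w ^ 2‖ - ‖c‖ ≤ ‖quad c w‖ := by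
    have := norm_sub_norm_le (w ^ 2) (-c)
    rwa [norm_neg, sub_neg_eq_add] at this
  rw [norm_pow] at h1
  nlinarith [norm_nonneg c, norm_nonneg w]

theorem mem_quadBasin_iff {w : ℂ} :
    w ∈ quadBasin c ↔ Tendsto (fun n : ℕ => ‖(quad c)^[n] w‖) atTop atTop := Iff.rfl

theorem mem_quadBasin_of_le_norm {w : ℂ} (hw : ‖c‖ + 2 ≤ ‖w‖) : w ∈ quadBasin c := by
  have key : ∀ n : ℕ, 2 ^ n * ‖w‖ ≤ ‖(quad c)^[n] w‖ ∧ ‖c‖ + 2 ≤ ‖(quad c)^[n] w‖ := by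
    intro n
    induction n with
    | zero => simpa using hw
    | succ n ih =>
      rw [Function.iterate_succ_apply']
      have := two_mul_norm_le_norm_quad ih.2
      constructor
      · rw [pow_succ]; linarith [ih.1]
      · linarith [norm_nonneg ((quad c)^[n] w), ih.2]
  rw [mem_quadBasin_iff]
  refine tendsto_atTop_mono (fun n => (key n).1) ?_
  refine Tendsto.atTop_mul_const ?_ (tendsto_pow_atTop_atTop_of_one_lt (by norm_num))
  linarith [norm_nonneg c]

theorem quad_mem_quadBasin_iff {w : ℂ} : quad c w ∈ quadBasin c ↔ w ∈ quadBasin c := by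
  rw [mem_quadBasin_iff, mem_quadBasin_iff, ← tendsto_add_atTop_iff_nat (f := fun n : ℕ => ‖(quad c)^[n] w‖) 1]
  rfl

theorem quad_iterate_mem_quadBasin_iff {w : ℂ} (n : ℕ) :
    (quad c)^[n] w ∈ quadBasin c ↔ w ∈ quadBasin c := by
  induction n with
  | zero => rfl
  | succ n ih => rw [Function.iterate_succ_apply', quad_mem_quadBasin_iff, ih]

theorem norm_quad_iterate_lt {w : ℂ} (hw : w ∉ quadBasin c) (n : ℕ) :
    ‖(quad c)^[n] w‖ < ‖c‖ + 2 := by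
  by_contra h
  exact hw ((quad_iterate_mem_quadBasin_iff n).mp (mem_quadBasin_of_le_norm (not_lt.mp h)))

theorem isOpen_quadBasin (c : ℂ) : IsOpen (quadBasin c) := by
  have : quadBasin c = ⋃ n : ℕ, {w | ‖c‖ + 2 < ‖(quad c)^[n] w‖} := by
    ext w
    simp only [mem_iUnion, mem_ofPred_eq]
    constructor
    · intro hw
      exact ((mem_quadBasin_iff.mp hw).eventually_gt_atTop (‖c‖ + 2)).exists
    · rintro ⟨n, hn⟩
      exact (quad_iterate_mem_quadBasin_iff n).mp (mem_quadBasin_of_le_norm hn.le)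
  rw [this]
  exact isOpen_iUnion fun n => isOpen_lt continuous_const (continuous_quad_iterate c n).norm

theorem notMem_quadBasin_of_fixed {a : ℂ} (ha : quad c a = a) : a ∉ quadBasin c := by
  intro h
  rw [mem_quadBasin_iff] at h
  have : (fun n : ℕ => ‖(quad c)^[n] a‖) = fun _ => ‖a‖ := by
    funext n
    rw [Function.iterate_fixed ha]
  rw [this] at h
  exact not_tendsto_const_atTop _ _ h

end Basin

/-! ### The Böttcher function and its sublevel domains -/

namespace IsBottcher

variable {c : ℂ} {B : ℂ → ℂ} (hB : IsBottcher c B)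
include hB

theorem one_lt_norm {w : ℂ} (hw : w ∈ quadBasin c) : 1 < ‖B w‖ := hB.2.1.mapsTo hw

theorem map_quad {w : ℂ} (hw : w ∈ quadBasin c) : B (quad c w) = B w ^ 2 := hB.2.2.1 w hw

theorem map_quad_iterate {w : ℂ} (hw : w ∈ quadBasin c) (n : ℕ) :
    B ((quad c)^[n] w) = B w ^ 2 ^ n := by
  induction n with
  | zero => simp
  | succ n ih =>
    rw [Function.iterate_succ_apply', hB.map_quad ((quad_iterate_mem_quadBasin_iff n).mpr hw), ih,
      ← pow_mul, pow_succ]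

theorem exists_norm_bounds :
    ∃ R, ‖c‖ + 2 ≤ R ∧ ∀ w, R < ‖w‖ → ‖w‖ / 2 ≤ ‖B w‖ ∧ ‖B w‖ ≤ 2 * ‖w‖ := by
  have h := (hB.2.2.2.norm).eventually (Ioo_mem_nhds (a := (1 / 2 : ℝ)) (b := 2)
    (by norm_num) (by norm_num))
  rw [← Metric.cobounded_eq_cocompact, ← comap_norm_atTop, eventually_comap] at h
  obtain ⟨R, hR⟩ := eventually_atTop.mp h
  refine ⟨max R (‖c‖ + 2), le_max_right _ _, fun w hw => ?_⟩
  have h1 := hR ‖w‖ ((le_max_left _ _).trans hw.le) w rfl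
  have hpos : 0 < ‖w‖ := by
    have := (le_max_right R (‖c‖ + 2)).trans_lt hw
    linarith [norm_nonneg c]
  rw [norm_div, lt_div_iff₀ hpos, div_lt_iff₀ hpos] at h1
  constructor <;> linarith [h1.1, h1.2]

/-- Follow the orbit until it first leaves a large disk of radius $T$. The exit point has modulus at
most $T^2+|c|$, so $|B|$ is controlled there by the asymptotics at infinity; going back along the
orbit only decreases $|B|$, as $|B|>1$ is squared at each step. -/
theorem exists_norm_le (r : ℝ) : ∃ M, 1 < M ∧ ∀ w ∈ quadBasin c, ‖w‖ ≤ r → ‖B w‖ ≤ M := by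
  obtain ⟨R, hR, hRB⟩ := hB.exists_norm_bounds
  set T := max r R
  have hT : 2 ≤ T := by linarith [norm_nonneg c, le_max_right r R]
  refine ⟨2 * (T ^ 2 + ‖c‖), by nlinarith [norm_nonneg c], fun w hw hwr => ?_⟩
  have hex : ∃ k, T < ‖(quad c)^[k] w‖ :=
    ((mem_quadBasin_iff.mp hw).eventually_gt_atTop T).exists
  classical
  obtain ⟨k, hk⟩ : ∃ k, Nat.find hex = k + 1 := by
    apply Nat.exists_eq_succ_of_ne_zero
    intro h0
    have := Nat.find_spec hex
    rw [h0] at this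
    exact absurd this (not_lt.mpr (hwr.trans (le_max_left _ _)))
  have h1 : T < ‖(quad c)^[k + 1] w‖ := hk ▸ Nat.find_spec hex
  have h2 : ‖(quad c)^[k] w‖ ≤ T := not_lt.mp (Nat.find_min hex (by omega))
  have h3 : ‖(quad c)^[k + 1] w‖ ≤ T ^ 2 + ‖c‖ := by
    rw [Function.iterate_succ_apply']
    refine (norm_quad_le c _).trans ?_
    gcongr
  have h4 := (hRB _ ((le_max_right r R).trans_lt h1)).2
  rw [hB.map_quad_iterate hw, norm_pow] at h4
  have h5 : ‖B w‖ ≤ ‖B w‖ ^ 2 ^ (k + 1) := le_self_pow₀ (hB.one_lt_norm hw).le (by positivity)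
  linarith

/-- The $n$-th iterates of points near $w_0$ stay in a fixed disk, where $|B|\le M$. Hence
$|B|^{2^n}\le M$ near $w_0$, and $n$ is arbitrary. This says that $|B|$ extends continuously by $1$
across the boundary of the basin. -/
theorem eventually_norm_lt {w₀ : ℂ} (hw₀ : w₀ ∉ quadBasin c) {ρ : ℝ} (hρ : 1 < ρ) :
    ∀ᶠ w in 𝓝 w₀, w ∈ quadBasin c → ‖B w‖ < ρ := by
  obtain ⟨M, hM, hMB⟩ := hB.exists_norm_le (‖c‖ + 2)
  obtain ⟨n, hn⟩ := pow_unbounded_of_one_lt M hρ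
  have hev : ∀ᶠ w in 𝓝 w₀, ‖(quad c)^[n] w‖ < ‖c‖ + 2 :=
    (continuous_quad_iterate c n).norm.continuousAt.eventually_lt_const (norm_quad_iterate_lt hw₀ n)
  filter_upwards [hev] with w hw hwb
  have h1 := hMB _ ((quad_iterate_mem_quadBasin_iff n).mpr hwb) hw.le
  rw [hB.map_quad_iterate hwb, norm_pow] at h1
  have h2 : ρ ^ n ≤ ρ ^ 2 ^ n := pow_le_pow_right₀ hρ.le n.lt_two_pow_self.le
  exact lt_of_pow_lt_pow_left₀ _ (by linarith) (h1.trans_lt (hn.trans_le h2))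

theorem continuousOn : ContinuousOn B (quadBasin c) := hB.1.continuousOn

theorem isOpen_sublevel {ρ : ℝ} (hρ : 1 < ρ) : IsOpen {w | w ∈ quadBasin c → ‖B w‖ < ρ} := by
  rw [isOpen_iff_mem_nhds]
  intro w hw
  by_cases hwb : w ∈ quadBasin c
  · have h1 := (hB.continuousOn.continuousAt ((isOpen_quadBasin c).mem_nhds hwb)).norm
    filter_upwards [h1.eventually_lt_const (hw hwb)] with x hx _ using hx
  · exact hB.eventually_norm_lt hwb hρ

theorem isClosed_sublevel (ρ : ℝ) : IsClosed {w | w ∈ quadBasin c → ‖B w‖ ≤ ρ} := by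
  rw [← isOpen_compl_iff]
  have : {w | w ∈ quadBasin c → ‖B w‖ ≤ ρ}ᶜ = quadBasin c ∩ (fun w => ‖B w‖) ⁻¹' Ioi ρ := by
    ext w; simp
  rw [this]
  exact hB.continuousOn.norm.isOpen_inter_preimage (isOpen_quadBasin c) isOpen_Ioi

theorem exists_sublevel_subset_ball (ρ : ℝ) :
    ∃ r, {w | w ∈ quadBasin c → ‖B w‖ ≤ ρ} ⊆ Metric.ball 0 r := by
  obtain ⟨R, hR, hRB⟩ := hB.exists_norm_bounds
  refine ⟨max R (2 * ρ) + 1, fun w hw => ?_⟩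
  rw [mem_ball_zero_iff]
  by_contra hcon
  push Not at hcon
  have h1 : R < ‖w‖ := by linarith [le_max_left R (2 * ρ)]
  have h2 := (hRB w h1).1
  have h3 := hw (mem_quadBasin_of_le_norm (hR.trans h1.le))
  linarith [le_max_right R (2 * ρ)]

theorem isCompact_sublevel (ρ : ℝ) : IsCompact {w | w ∈ quadBasin c → ‖B w‖ ≤ ρ} := by
  obtain ⟨r, hr⟩ := hB.exists_sublevel_subset_ball ρ
  exact Metric.isCompact_of_isClosed_isBounded (hB.isClosed_sublevel ρ)
    (Metric.isBounded_ball.subset hr)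

theorem nhds_le_map {w : ℂ} (hw : w ∈ quadBasin c) : 𝓝 (B w) ≤ map B (𝓝 w) := by
  apply nhds_le_map_nhds_of_finite_fiber (isOpen_quadBasin c) hw hB.1
  apply Set.Subsingleton.finite
  rintro x ⟨hx1, hx2⟩ y ⟨hy1, hy2⟩
  exact hB.2.1.injOn hx1 hy1 (hx2.trans hy2.symm)

/-- The functional equation gives $B(-w)^2=B(w)^2$, and injectivity leaves only $B(-w)=-B(w)$ for
$w\ne0$. At $w\to0$ this would give $B(0)=0$, against $|B|>1$. -/
theorem zero_notMem_quadBasin : (0 : ℂ) ∉ quadBasin c := by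
  intro h0
  have hne : ∀ᶠ w in 𝓝 (0 : ℂ), w ∈ quadBasin c := (isOpen_quadBasin c).mem_nhds h0
  have hne' : ∀ᶠ w in 𝓝 (0 : ℂ), -w ∈ quadBasin c := by
    have : Tendsto (fun w : ℂ => -w) (𝓝 0) (𝓝 0) := by
      simpa using (continuous_neg (G := ℂ)).tendsto 0
    exact this.eventually hne
  have hodd : ∀ᶠ w in 𝓝[≠] (0 : ℂ), B (-w) = -B w := by
    filter_upwards [hne.filter_mono nhdsWithin_le_nhds, hne'.filter_mono nhdsWithin_le_nhds,
      self_mem_nhdsWithin] with w h1 h2 h3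
    have h4 : B (-w) ^ 2 = B w ^ 2 := by
      rw [← hB.map_quad h1, ← hB.map_quad h2, quad_neg]
    rcases sq_eq_sq_iff_eq_or_eq_neg.mp h4 with h5 | h5
    · exfalso
      have := hB.2.1.injOn h2 h1 h5
      apply h3
      rw [mem_singleton_iff, ← self_eq_neg]
      exact this.symm
    · exact h5
  have hc : ContinuousAt B 0 := hB.continuousOn.continuousAt hne
  have hc' : ContinuousAt (fun w => B (-w)) 0 := by
    apply ContinuousAt.comp
    · simpa using hc
    · exact continuous_neg.continuousAt
  have t1 : Tendsto (fun w => B (-w)) (𝓝[≠] 0) (𝓝 (B 0)) := by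
    simpa using hc'.tendsto.mono_left nhdsWithin_le_nhds
  have t2 : Tendsto (fun w => -B w) (𝓝[≠] 0) (𝓝 (-B 0)) :=
    (hc.tendsto.mono_left nhdsWithin_le_nhds).neg
  have h6 := tendsto_nhds_unique (t1.congr' hodd) t2
  have h7 : B 0 = 0 := self_eq_neg.mp h6
  have := hB.one_lt_norm h0
  rw [h7, norm_zero] at this
  linarith

end IsBottcher

/-! ### The inverse Böttcher function and connectedness of sublevels -/

/-- The inverse of the Böttcher function. -/
noncomputable def bottcherInv (c : ℂ) (B : ℂ → ℂ) : ℂ → ℂ := Function.invFunOn B (quadBasin c)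

namespace IsBottcher

variable {c : ℂ} {B : ℂ → ℂ} (hB : IsBottcher c B)
include hB

theorem inv_mem {v : ℂ} (hv : 1 < ‖v‖) : bottcherInv c B v ∈ quadBasin c :=
  Function.invFunOn_mem (hB.2.1.surjOn hv)

theorem apply_inv {v : ℂ} (hv : 1 < ‖v‖) : B (bottcherInv c B v) = v :=
  Function.invFunOn_eq (hB.2.1.surjOn hv)

theorem inv_apply {w : ℂ} (hw : w ∈ quadBasin c) : bottcherInv c B (B w) = w :=
  hB.2.1.injOn (hB.inv_mem (hB.one_lt_norm hw)) hw (hB.apply_inv (hB.one_lt_norm hw))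

theorem eq_inv {v w : ℂ} (hw : w ∈ quadBasin c) (h : B w = v) : w = bottcherInv c B v := by
  rw [← h, hB.inv_apply hw]

theorem quad_inv {v : ℂ} (hv : 1 < ‖v‖) : quad c (bottcherInv c B v) = bottcherInv c B (v ^ 2) := by
  apply hB.eq_inv (quad_mem_quadBasin_iff.mpr (hB.inv_mem hv))
  rw [hB.map_quad (hB.inv_mem hv), hB.apply_inv hv]

theorem continuousAt_inv {v : ℂ} (hv : 1 < ‖v‖) : ContinuousAt (bottcherInv c B) v := by
  have hw := hB.inv_mem hv
  intro N hN
  have h1 : B '' (N ∩ quadBasin c) ∈ 𝓝 (B (bottcherInv c B v)) :=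
    hB.nhds_le_map hw (image_mem_map (inter_mem hN ((isOpen_quadBasin c).mem_nhds hw)))
  rw [hB.apply_inv hv] at h1
  rw [mem_map]
  filter_upwards [h1]
  rintro _ ⟨x, ⟨hx1, hx2⟩, rfl⟩
  rwa [mem_preimage, hB.inv_apply hx2]

theorem continuousOn_inv : ContinuousOn (bottcherInv c B) {v | 1 < ‖v‖} :=
  fun _ hv => (hB.continuousAt_inv hv).continuousWithinAt

/-- Connectedness of sectors `{exp ζ}` in the Böttcher coordinate. -/
theorem isPreconnected_image_exp {T : Set ℂ} (hT : IsPreconnected T) (hpos : ∀ ζ ∈ T, 0 < ζ.re) :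
    IsPreconnected ((fun ζ => bottcherInv c B (Complex.exp ζ)) '' T) := by
  apply hT.image
  apply hB.continuousOn_inv.comp (by fun_prop)
  intro ζ hζ
  rw [mem_ofPred_eq, Complex.norm_exp]
  exact Real.one_lt_exp_iff.mpr (hpos ζ hζ)

/-- The part in the basin is an annulus, the image of a strip under $\exp$. A relatively clopen part
that misses this annulus is closed in the whole plane, since its closure avoids the open basin;
being also open and not the plane, it is empty. -/
theorem isPreconnected_sublevel {ρ : ℝ} (hρ : 1 < ρ) :
    IsPreconnected {w | w ∈ quadBasin c → ‖B w‖ < ρ} := by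
  set D := {w | w ∈ quadBasin c → ‖B w‖ < ρ} with hD
  have hDo : IsOpen D := hB.isOpen_sublevel hρ
  set T : Set ℂ := {ζ | 0 < ζ.re ∧ ζ.re < Real.log ρ}
  have hT : IsPreconnected T :=
    ((convex_halfSpace_re_gt 0).inter (convex_halfSpace_re_lt _)).isPreconnected
  have hann := hB.isPreconnected_image_exp hT fun ζ h => h.1
  set A := (fun ζ => bottcherInv c B (Complex.exp ζ)) '' T
  have hA : A = D ∩ quadBasin c := by
    ext w
    constructor
    · rintro ⟨ζ, ⟨h1, h2⟩, rfl⟩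
      have h3 : 1 < ‖Complex.exp ζ‖ := by
        rw [Complex.norm_exp]; exact Real.one_lt_exp_iff.mpr h1
      refine ⟨fun _ => ?_, hB.inv_mem h3⟩
      rw [hB.apply_inv h3, Complex.norm_exp]
      rwa [← Real.lt_log_iff_exp_lt (by linarith)]
    · rintro ⟨h1, h2⟩
      have h3 := hB.one_lt_norm h2
      have h4 : B w ≠ 0 := by
        intro h; rw [h, norm_zero] at h3; linarith
      refine ⟨Complex.log (B w), ⟨?_, ?_⟩, ?_⟩
      · rw [Complex.log_re]; exact Real.log_pos h3
      · rw [Complex.log_re]; exact Real.log_lt_log (by linarith) (h1 h2)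
      · simp only [Complex.exp_log h4]
        exact hB.inv_apply h2
  rw [isPreconnected_iff_subset_of_disjoint]
  intro U V hU hV hcov hdisj
  -- a relatively clopen open subset of `D` that misses the basin is empty
  have key : ∀ U V : Set ℂ, IsOpen U → IsOpen V → D ⊆ U ∪ V → D ∩ (U ∩ V) = ∅ → A ⊆ U → D ⊆ U := by
    intro U V hU hV hcov hdisj hAU
    have hVK : ∀ w ∈ D ∩ V, w ∉ quadBasin c := by
      rintro w ⟨hw1, hw2⟩ hwb
      have : w ∈ D ∩ (U ∩ V) := ⟨hw1, hAU (hA ▸ ⟨hw1, hwb⟩), hw2⟩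
      rw [hdisj] at this
      exact this
    have hclosed : IsClosed (D ∩ V) := by
      rw [← closure_subset_iff_isClosed]
      intro w hw
      have hwK : w ∉ quadBasin c := by
        have : closure (D ∩ V) ⊆ (quadBasin c)ᶜ :=
          closure_minimal hVK (isOpen_quadBasin c).isClosed_compl
        exact this hw
      have hwD : w ∈ D := fun h => absurd h hwK
      rcases hcov hwD with hwU | hwV
      · obtain ⟨x, hx1, hx2⟩ := mem_closure_iff.mp hw _ hU hwU
        have : x ∈ D ∩ (U ∩ V) := ⟨hx2.1, hx1, hx2.2⟩
        rw [hdisj] at this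
        exact absurd this (notMem_empty _)
      · exact ⟨hwD, hwV⟩
    rcases isClopen_iff.mp ⟨hclosed, hDo.inter hV⟩ with h | h
    · intro w hw
      rcases hcov hw with h1 | h1
      · exact h1
      · have : w ∈ D ∩ V := ⟨hw, h1⟩
        rw [h] at this
        exact absurd this (notMem_empty _)
    · have : ((‖c‖ + 2 : ℝ) : ℂ) ∈ D ∩ V := h ▸ mem_univ _
      refine absurd (mem_quadBasin_of_le_norm ?_) (hVK _ this)
      rw [Complex.norm_real, Real.norm_eq_abs]
      exact le_abs_self _
  rcases (isPreconnected_iff_subset_of_disjoint.mp hann) U V hU hV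
    ((hA ▸ inter_subset_left : A ⊆ D).trans hcov)
    (by
      rw [← subset_empty_iff, ← hdisj]
      exact inter_subset_inter_left _ (hA ▸ inter_subset_left)) with h | h
  · exact Or.inl (key U V hU hV hcov hdisj h)
  · exact Or.inr (key V U hV hU (union_comm U V ▸ hcov) (inter_comm U V ▸ hdisj) h)

end IsBottcher

/-! ### External rays and their landing points -/

/-- Near `θ₀`, other angles give other points of the circle. -/
theorem eventually_circleExp_notMem {T : Set Circle} (hT : T.Finite) (θ₀ : ℝ) :
    ∀ᶠ θ in 𝓝[≠] θ₀, Circle.exp θ ∉ T := by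
  have : ∀ᶠ θ in 𝓝[≠] θ₀, ∀ v ∈ T, Circle.exp θ ≠ v := by
    rw [Filter.eventually_all_finite hT]
    intro v _
    by_cases hv : Circle.exp θ₀ = v
    · have h1 : ∀ᶠ θ in 𝓝[≠] θ₀, |θ - θ₀| < 2 * Real.pi := by
        refine eventually_nhdsWithin_of_eventually_nhds ?_
        have : Continuous fun θ : ℝ => |θ - θ₀| := by fun_prop
        apply this.continuousAt.eventually_lt_const
        simp [Real.pi_pos]
      filter_upwards [h1, self_mem_nhdsWithin] with θ h1 h2 h3
      obtain ⟨m, hm⟩ := Circle.exp_eq_exp.mp (h3.trans hv.symm)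
      have h4 : |(m : ℝ)| * (2 * Real.pi) < 1 * (2 * Real.pi) := by
        rw [hm, add_sub_cancel_left, abs_mul, abs_of_pos Real.two_pi_pos] at h1
        linarith
      have h5 := lt_of_mul_lt_mul_right h4 Real.two_pi_pos.le
      have h6 : |m| < 1 := by exact_mod_cast h5
      rw [Int.abs_lt_one_iff] at h6
      apply h2
      simp [hm, h6]
    · exact eventually_nhdsWithin_of_eventually_nhds
        ((Circle.exp.continuous.continuousAt (x := θ₀)).eventually_ne hv)
  filter_upwards [this] with θ h1 h2 using h1 _ h2 rfl

/-- The points of argument `arg u` in the Böttcher coordinate `B`. -/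
def bottcherRay (c : ℂ) (B : ℂ → ℂ) (u : Circle) : Set ℂ :=
  {w | w ∈ quadBasin c ∧ ∃ r : ℝ, 1 < r ∧ B w = r * u}

/-- The ray of argument `arg u` lands at `a`. -/
def BottcherRayLandsAt (c : ℂ) (B : ℂ → ℂ) (u : Circle) (a : ℂ) : Prop :=
  Tendsto (fun r : ℝ => bottcherInv c B (r * u)) (𝓝[>] 1) (𝓝 a)

theorem norm_ofReal_mul_circle {r : ℝ} (hr : 0 < r) (u : Circle) : ‖(r : ℂ) * u‖ = r := by
  rw [norm_mul, Circle.norm_coe, mul_one, Complex.norm_real, Real.norm_of_nonneg hr.le]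

theorem one_lt_norm_ofReal_mul_circle {r : ℝ} (hr : 1 < r) (u : Circle) : 1 < ‖(r : ℂ) * u‖ := by
  rwa [norm_ofReal_mul_circle (by linarith)]

theorem ofReal_mul_circle_inj {r r' : ℝ} (hr : 0 < r) (hr' : 0 < r') {u u' : Circle}
    (h : (r : ℂ) * u = r' * u') : r = r' ∧ u = u' := by
  have h1 : r = r' := by
    rw [← norm_ofReal_mul_circle hr u, h, norm_ofReal_mul_circle hr']
  refine ⟨h1, ?_⟩
  subst h1
  exact Subtype.ext (mul_left_cancel₀ (by exact_mod_cast hr.ne') h)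

theorem exp_eq_ofReal_mul_circle (ζ : ℂ) :
    Complex.exp ζ = (Real.exp ζ.re : ℝ) * (Circle.exp ζ.im : Circle) := by
  rw [Circle.coe_exp, Complex.ofReal_exp, ← Complex.exp_add, Complex.re_add_im]

namespace IsBottcher

variable {c : ℂ} {B : ℂ → ℂ} (hB : IsBottcher c B)
include hB

theorem inv_mem_ray {r : ℝ} (hr : 1 < r) (u : Circle) : bottcherInv c B (r * u) ∈ bottcherRay c B u :=
  have h := one_lt_norm_ofReal_mul_circle hr u
  ⟨hB.inv_mem h, r, hr, hB.apply_inv h⟩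

theorem exists_mem_ray {w : ℂ} (hw : w ∈ quadBasin c) :
    ∃ u : Circle, w ∈ bottcherRay c B u ∧ B w = ‖B w‖ * u := by
  have h1 := hB.one_lt_norm hw
  have h0 : B w ≠ 0 := norm_pos_iff.mp (by linarith)
  refine ⟨⟨B w / ‖B w‖, ?_⟩, ?_⟩
  · rw [Submonoid.unitSphere, Submonoid.mem_mk, Subsemigroup.mem_mk, mem_sphere_zero_iff_norm, norm_div,
      Complex.norm_real, norm_norm, div_self (by positivity)]
  · have h2 : B w = ‖B w‖ * (B w / ‖B w‖) := by
      rw [mul_div_cancel₀]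
      exact_mod_cast norm_ne_zero_iff.mpr h0
    exact ⟨⟨hw, ‖B w‖, h1, h2⟩, h2⟩

omit hB in
theorem ray_unique {w : ℂ} {u v : Circle} (hu : w ∈ bottcherRay c B u)
    (hv : w ∈ bottcherRay c B v) : u = v := by
  obtain ⟨_, r, hr, h1⟩ := hu
  obtain ⟨_, s, hs, h2⟩ := hv
  exact (ofReal_mul_circle_inj (by linarith) (by linarith) (h1.symm.trans h2)).2

theorem mem_ray_iff {w : ℂ} {u : Circle} (hw : w ∈ quadBasin c) :
    w ∈ bottcherRay c B u ↔ B w = ‖B w‖ * u := by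
  constructor
  · rintro ⟨_, r, hr, h⟩
    rw [h, norm_ofReal_mul_circle (by linarith)]
  · intro h
    exact ⟨hw, ‖B w‖, hB.one_lt_norm hw, h⟩

theorem quad_iterate_inv {r : ℝ} (hr : 1 < r) (u : Circle) (n : ℕ) :
    (quad c)^[n] (bottcherInv c B (r * u)) =
      bottcherInv c B ((r ^ 2 ^ n : ℝ) * (u ^ 2 ^ n : Circle)) := by
  have h := one_lt_norm_ofReal_mul_circle hr u
  apply hB.eq_inv ((quad_iterate_mem_quadBasin_iff n).mpr (hB.inv_mem h))
  rw [hB.map_quad_iterate (hB.inv_mem h), hB.apply_inv h, mul_pow]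
  push_cast
  rfl

theorem quad_mem_ray {w : ℂ} {u : Circle} (hw : w ∈ bottcherRay c B u) :
    quad c w ∈ bottcherRay c B (u ^ 2) := by
  obtain ⟨h1, r, hr, h2⟩ := hw
  refine ⟨quad_mem_quadBasin_iff.mpr h1, r ^ 2, one_lt_pow₀ hr two_ne_zero, ?_⟩
  rw [hB.map_quad h1, h2, mul_pow]
  push_cast
  rfl

theorem continuousOn_ray (u : Circle) :
    ContinuousOn (fun r : ℝ => bottcherInv c B (r * u)) (Ioi 1) := by
  apply hB.continuousOn_inv.comp (by fun_prop)
  intro r hr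
  exact one_lt_norm_ofReal_mul_circle hr u

/-- Rays go to infinity. -/
theorem exists_far (M : ℝ) : ∃ R : ℝ, 1 < R ∧ ∀ r : ℝ, R ≤ r → ∀ u : Circle, M < ‖bottcherInv c B (r * u)‖ := by
  obtain ⟨M', h1, hM'⟩ := hB.exists_norm_le M
  refine ⟨M' + 1, by linarith, fun r hr u => ?_⟩
  by_contra! hcon
  have h3 : 1 < r := by linarith
  have h2 := hM' _ (hB.inv_mem (one_lt_norm_ofReal_mul_circle h3 u)) hcon
  rw [hB.apply_inv (one_lt_norm_ofReal_mul_circle h3 u), norm_ofReal_mul_circle (by linarith)] at h2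
  linarith

theorem joinedIn_ray {u : Circle} {a : ℂ} (ha : BottcherRayLandsAt c B u a) {R : ℝ} (hR : 1 < R) :
    JoinedIn (insert a (bottcherRay c B u)) a (bottcherInv c B (R * u)) := by
  set φ : ℝ → ℝ := fun t => 1 + t * (R - 1)
  have hφ : Continuous φ := by fun_prop
  have hφ1 : ∀ t, 0 < t → 1 < φ t := fun t ht => by
    have : 0 < t * (R - 1) := mul_pos ht (by linarith)
    simp only [φ]; linarith
  have hcont : ContinuousOn (Function.update (fun t => bottcherInv c B (φ t * u)) 0 a)
      (Icc 0 1) := by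
    intro t ht
    rcases eq_or_lt_of_le ht.1 with rfl | h0
    · rw [continuousWithinAt_update_same]
      have h1 : Tendsto φ (𝓝[Icc 0 1 \ {0}] 0) (𝓝[>] 1) := by
        rw [tendsto_nhdsWithin_iff]
        constructor
        · have : φ 0 = 1 := by simp [φ]
          rw [← this]
          exact hφ.continuousAt.tendsto.mono_left nhdsWithin_le_nhds
        · filter_upwards [self_mem_nhdsWithin] with t ht
          exact hφ1 t (lt_of_le_of_ne ht.1.1 (Ne.symm ht.2))
      have h2 : Tendsto (fun r : ℝ => bottcherInv c B (r * u)) (𝓝[>] 1) (𝓝 a) := ha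
      exact h2.comp h1
    · rw [continuousWithinAt_update_of_ne h0.ne']
      apply ContinuousAt.continuousWithinAt
      have h2 := (hB.continuousOn_ray u).continuousAt (Ioi_mem_nhds (hφ1 t h0))
      exact ContinuousAt.comp (f := φ) h2 hφ.continuousAt
  refine JoinedIn.ofLine hcont (by simp) ?_ ?_
  · rw [Function.update_of_ne one_ne_zero]
    simp [φ]
  · rintro _ ⟨t, ht, rfl⟩
    rcases eq_or_lt_of_le ht.1 with rfl | h0
    · simp
    · rw [Function.update_of_ne h0.ne']
      exact Or.inr (hB.inv_mem_ray (hφ1 t h0) u)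

theorem joinedIn_subray {u : Circle} {r R : ℝ} (hr : 1 < r) (hrR : r ≤ R) :
    JoinedIn ((fun s : ℝ => bottcherInv c B (s * u)) '' Icc r R) (bottcherInv c B (r * u))
      (bottcherInv c B (R * u)) := by
  have hc : ContinuousOn (fun s : ℝ => bottcherInv c B (s * u)) (Icc r R) :=
    (hB.continuousOn_ray u).mono fun s hs => hr.trans_le hs.1
  have := ((convex_Icc r R).isPathConnected ⟨r, left_mem_Icc.mpr hrR⟩).image' hc
  exact this.joinedIn _ (mem_image_of_mem _ (left_mem_Icc.mpr hrR)) _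
    (mem_image_of_mem _ (right_mem_Icc.mpr hrR))

/-- If a ray lands at `P x`, then one of its preimages lands at `x`. -/
theorem exists_ray_landsAt {u : Circle} {x : ℂ} (h : BottcherRayLandsAt c B u (quad c x)) :
    ∃ v : Circle, v ^ 2 = u ∧ BottcherRayLandsAt c B v x := by
  obtain ⟨v, hv⟩ : ∃ v : Circle, v ^ 2 = u := by
    refine ⟨Circle.exp (Complex.arg u / 2), ?_⟩
    rw [sq, ← Circle.exp_add, add_halves, Circle.exp_arg]
  -- The square of the point of radius $r$ on the ray $v$ is the point of radius $r^2$ on the ray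
  -- $u$, minus $c$. It remains to choose the root: the ray $v$ or its opposite.
  have hsq : Tendsto (fun r : ℝ => bottcherInv c B (r * v) ^ 2) (𝓝[>] 1) (𝓝 (x ^ 2)) := by
    have h1 : Tendsto (fun r : ℝ => r ^ 2) (𝓝[>] 1) (𝓝[>] 1) := by
      rw [tendsto_nhdsWithin_iff]
      constructor
      · have : Continuous fun r : ℝ => r ^ 2 := by fun_prop
        simpa using (this.tendsto 1).mono_left nhdsWithin_le_nhds
      · filter_upwards [self_mem_nhdsWithin] with r hr
        exact one_lt_pow₀ (mem_Ioi.mp hr) two_ne_zero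
    have h0 : Tendsto (fun r : ℝ => bottcherInv c B (r * u)) (𝓝[>] 1) (𝓝 (quad c x)) := h
    have h2 := (h0.comp h1).sub_const c
    rw [quad_apply, add_sub_cancel_right] at h2
    refine h2.congr' ?_
    filter_upwards [self_mem_nhdsWithin] with r hr
    have h3 := hB.quad_inv (one_lt_norm_ofReal_mul_circle hr v)
    rw [quad_apply, ← eq_sub_iff_add_eq] at h3
    rw [h3, mul_pow, ← hv]
    simp only [Function.comp_apply]
    push_cast
    rfl
  have hneg : ∀ v : Circle, ∀ r : ℝ, 1 < r →
      bottcherInv c B (r * (-v : Circle)) = -bottcherInv c B (r * v) := by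
    intro v r hr
    have h1 := one_lt_norm_ofReal_mul_circle hr v
    have h2 := one_lt_norm_ofReal_mul_circle hr (-v)
    have h3 : quad c (bottcherInv c B (r * (-v : Circle))) = quad c (bottcherInv c B (r * v)) := by
      rw [hB.quad_inv h1, hB.quad_inv h2]
      congr 1
      simp
    refine (quad_eq_quad_iff.mp h3).resolve_left fun h4 => ?_
    have h5 := hB.apply_inv h2
    rw [h4, hB.apply_inv h1] at h5
    have h6 := (ofReal_mul_circle_inj (by linarith) (by linarith) h5).2
    have h7 : (v : ℂ) = -v := by
      simpa using congrArg (Subtype.val) h6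
    exact Circle.coe_ne_zero v (self_eq_neg.mp h7)
  by_cases hx : x = 0
  · refine ⟨v, hv, ?_⟩
    subst hx
    have h1 := (Real.continuous_sqrt.tendsto _).comp hsq.norm
    refine tendsto_zero_iff_norm_tendsto_zero.mpr ?_
    simpa [Function.comp_def, norm_pow, Real.sqrt_sq] using h1
  -- With $q$ the quotient of the ray point by $x$, $\operatorname{Re}q>0$ gives $|q+1|\ge1$, hence
  -- $|q-1|\le|q^2-1|\to0$.
  have hpos : ∀ v : Circle,
      Tendsto (fun r : ℝ => bottcherInv c B (r * v) ^ 2) (𝓝[>] 1) (𝓝 (x ^ 2)) →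
      (∀ᶠ r : ℝ in 𝓝[>] 1, 0 < (bottcherInv c B (r * v) / x).re) → BottcherRayLandsAt c B v x := by
    intro v hsq hre
    have h1 : Tendsto (fun r : ℝ => ‖(bottcherInv c B (r * v) / x) ^ 2 - 1‖) (𝓝[>] 1) (𝓝 0) := by
      have h2 := ((hsq.div_const (x ^ 2)).sub_const 1).norm
      rw [div_self (pow_ne_zero 2 hx), sub_self, norm_zero] at h2
      simpa only [div_pow] using h2
    have h2 : Tendsto (fun r : ℝ => bottcherInv c B (r * v) / x - 1) (𝓝[>] 1) (𝓝 0) := by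
      refine squeeze_zero_norm' ?_ h1
      filter_upwards [hre] with r hr
      set q := bottcherInv c B (r * v) / x
      have h3 : 1 ≤ ‖q + 1‖ := by
        refine le_trans ?_ (Complex.re_le_norm _)
        simp only [Complex.add_re, Complex.one_re]
        linarith
      have h4 : q ^ 2 - 1 = (q - 1) * (q + 1) := by ring
      rw [h4, norm_mul]
      exact le_mul_of_one_le_right (norm_nonneg _) h3
    have h3 := (h2.add_const 1).mul_const x
    rw [zero_add, one_mul] at h3
    refine h3.congr fun r => ?_
    rw [sub_add_cancel, div_mul_cancel₀ _ hx]
  -- Since $q^2\to1$, eventually $\operatorname{Re}q\ne0$; by connectedness its sign is constant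
  -- along the end of the ray and decides between $v$ and $-v$.
  have hne : ∀ᶠ r : ℝ in 𝓝[>] 1, (bottcherInv c B (r * v) / x).re ≠ 0 := by
    have h2 : Tendsto (fun r : ℝ => ((bottcherInv c B (r * v) / x) ^ 2).re) (𝓝[>] 1) (𝓝 1) := by
      have h3 := (Complex.continuous_re.tendsto _).comp (hsq.div_const (x ^ 2))
      rw [div_self (pow_ne_zero 2 hx), Complex.one_re] at h3
      simpa only [div_pow, Function.comp_def] using h3
    filter_upwards [h2.eventually_const_lt (zero_lt_one)] with r hr h0
    rw [sq, Complex.mul_re, h0] at hr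
    nlinarith [sq_nonneg (bottcherInv c B (r * v) / x).im]
  obtain ⟨ε, hε, hεne⟩ := mem_nhdsGT_iff_exists_Ioo_subset.mp hne
  have hIoo : Ioo 1 ε ∈ 𝓝[>] (1 : ℝ) := Ioo_mem_nhdsGT hε
  have hcont : ContinuousOn (fun r : ℝ => (bottcherInv c B (r * v) / x).re) (Ioo 1 ε) :=
    Complex.continuous_re.comp_continuousOn
      (((hB.continuousOn_ray v).mono Ioo_subset_Ioi_self).div_const x)
  have himage := isPreconnected_Ioo.image _ hcont
  by_cases hall : ∀ r ∈ Ioo 1 ε, 0 < (bottcherInv c B (r * v) / x).re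
  · exact ⟨v, hv, hpos v hsq (by filter_upwards [hIoo] using hall)⟩
  · push Not at hall
    obtain ⟨r₀, hr₀, hr₀'⟩ := hall
    refine ⟨-v, by simpa using hv, hpos (-v) (hsq.congr' ?_) ?_⟩
    · filter_upwards [self_mem_nhdsWithin] with r hr
      rw [hneg v r hr, neg_sq]
    · filter_upwards [hIoo] with r hr
      rw [hneg v r hr.1, neg_div, Complex.neg_re, neg_pos]
      by_contra! hcon
      obtain ⟨s, hs, hs'⟩ := himage.ordConnected.out (mem_image_of_mem _ hr₀) (mem_image_of_mem _ hr)
        ⟨hr₀', hcon⟩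
      exact hεne hs hs'

end IsBottcher

/-! ### The puzzle of the polynomial -/

/-- A quadratic polynomial with the rays landing at a fixed point `a` and an equipotential. -/
structure PolyPuzzle where
  c : ℂ
  B : ℂ → ℂ
  hB : IsBottcher c B
  a : ℂ
  fixed : quad c a = a
  angles : Set Circle
  finite_angles : angles.Finite
  nontrivial_angles : angles.Nontrivial
  lands : ∀ u ∈ angles, BottcherRayLandsAt c B u a
  sq_mem : ∀ u ∈ angles, u ^ 2 ∈ angles
  ρ : ℝ
  one_lt : 1 < ρ

namespace PolyPuzzle

variable (X : PolyPuzzle)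

/-- The domain bounded by the equipotential. -/
def dom : Set ℂ := {w | w ∈ quadBasin X.c → ‖X.B w‖ < X.ρ}

/-- The rays with angles in `T`, together with `a`. -/
def cut (T : Set Circle) : Set ℂ := {w | ∃ u ∈ T, w ∈ bottcherRay X.c X.B u} ∪ {X.a}

/-- The union of the open puzzle pieces of depth `n`. -/
def level (n : ℕ) : Set ℂ := (quad X.c)^[n] ⁻¹' (X.dom \ X.cut X.angles)

/-- The open puzzle piece of depth `n` containing `w`. -/
def piece (n : ℕ) (w : ℂ) : Set ℂ := connectedComponentIn (X.level n) w

theorem isOpen_dom : IsOpen X.dom := X.hB.isOpen_sublevel X.one_lt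

theorem a_notMem_basin : X.a ∉ quadBasin X.c := notMem_quadBasin_of_fixed X.fixed

theorem a_mem_dom : X.a ∈ X.dom := fun h => absurd h X.a_notMem_basin

/-- Inside the basin the rays are given by finitely many closed conditions on the argument of $B$.
Near a point outside the basin $|B|$ is close to $1$, and the parts of the finitely many rays with
$|B|$ close to $1$ are close to $a$, where they land. -/
theorem isClosed_cut {T : Set Circle} (hT : T ⊆ X.angles) : IsClosed (X.cut T) := by
  have hfin : T.Finite := X.finite_angles.subset hT
  rw [← isOpen_compl_iff, isOpen_iff_mem_nhds]
  intro w hw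
  by_cases hwb : w ∈ quadBasin X.c
  · have hO : IsOpen {v : ℂ | ∀ u ∈ T, v ≠ ‖v‖ * u} := by
      have : {v : ℂ | ∀ u ∈ T, v ≠ ‖v‖ * u} = ⋂ u ∈ T, {v : ℂ | v ≠ ‖v‖ * u} := by
        ext v; simp
      rw [this]
      refine hfin.isOpen_biInter fun u _ => isOpen_ne_fun continuous_id (by fun_prop)
    have hO' := X.hB.continuousOn.isOpen_inter_preimage (isOpen_quadBasin _) hO
    have hmem : w ∈ quadBasin X.c ∩ X.B ⁻¹' {v : ℂ | ∀ u ∈ T, v ≠ ‖v‖ * u} := by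
      refine ⟨hwb, fun u hu h => hw (Or.inl ⟨u, hu, (X.hB.mem_ray_iff hwb).mpr h⟩)⟩
    filter_upwards [hO'.mem_nhds hmem]
    rintro x ⟨hx1, hx2⟩ (⟨u, hu, hxu⟩ | hxa)
    · exact hx2 u hu ((X.hB.mem_ray_iff hx1).mp hxu)
    · rw [mem_singleton_iff.mp hxa] at hx1
      exact X.a_notMem_basin hx1
  · have hwa : w ≠ X.a := fun h => hw (Or.inr h)
    obtain ⟨N, A, hN, hA, hwN, haA, hdisj⟩ := t2_separation hwa
    have hev : ∀ᶠ r : ℝ in 𝓝[>] 1, ∀ u ∈ T, bottcherInv X.c X.B (r * u) ∈ A := by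
      rw [Filter.eventually_all_finite hfin]
      intro u hu
      exact (X.lands u (hT hu)).eventually (hA.mem_nhds haA)
    obtain ⟨ε, hε, hεA⟩ := mem_nhdsGT_iff_exists_Ioo_subset.mp hev
    filter_upwards [hN.mem_nhds hwN, X.hB.eventually_norm_lt hwb hε]
    rintro x hxN hx (⟨u, hu, hxb, r, hr, hBx⟩ | hxa)
    · have h1 := hx hxb
      rw [hBx, norm_ofReal_mul_circle (by linarith)] at h1
      have h2 := hεA ⟨hr, h1⟩ u hu
      rw [← X.hB.eq_inv hxb hBx] at h2
      exact disjoint_left.mp hdisj hxN h2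
    · rw [mem_singleton_iff.mp hxa] at hxN
      exact disjoint_left.mp hdisj hxN haA

theorem isOpen_level (n : ℕ) : IsOpen (X.level n) :=
  (X.isOpen_dom.sdiff (X.isClosed_cut subset_rfl)).preimage (continuous_quad_iterate _ n)

theorem quad_mem_level_iff {n : ℕ} {w : ℂ} : quad X.c w ∈ X.level n ↔ w ∈ X.level (n + 1) := Iff.rfl

theorem quad_iterate_mem_level_iff {n k : ℕ} {w : ℂ} :
    (quad X.c)^[k] w ∈ X.level n ↔ w ∈ X.level (n + k) := by
  simp only [level, mem_preimage, Function.iterate_add_apply]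

theorem mem_dom_of_quad_mem {w : ℂ} (h : quad X.c w ∈ X.dom) : w ∈ X.dom := by
  intro hb
  have h1 := h (quad_mem_quadBasin_iff.mpr hb)
  rw [X.hB.map_quad hb, norm_pow] at h1
  exact (le_self_pow₀ (X.hB.one_lt_norm hb).le two_ne_zero).trans_lt h1

theorem quad_mem_cut {w : ℂ} (h : w ∈ X.cut X.angles) : quad X.c w ∈ X.cut X.angles := by
  rcases h with ⟨u, hu, hw⟩ | hw
  · exact Or.inl ⟨u ^ 2, X.sq_mem u hu, X.hB.quad_mem_ray hw⟩
  · rw [mem_singleton_iff.mp hw, X.fixed]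
    exact Or.inr rfl

/-- Pieces are nested because the cut is forward invariant and the polynomial increases $|B|$. -/
theorem level_succ_subset (n : ℕ) : X.level (n + 1) ⊆ X.level n := by
  intro w hw
  rw [level, mem_preimage, Function.iterate_succ_apply'] at hw
  exact ⟨X.mem_dom_of_quad_mem hw.1, fun h => hw.2 (X.quad_mem_cut h)⟩

theorem level_anti : Antitone X.level := antitone_nat_of_succ_le X.level_succ_subset

theorem level_subset_dom (n : ℕ) : X.level n ⊆ X.dom :=
  (X.level_anti (Nat.zero_le n)).trans sdiff_subset

theorem mem_level_of_mem_piece {n : ℕ} {x w : ℂ} (h : x ∈ X.piece n w) : x ∈ X.level n :=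
  connectedComponentIn_subset _ _ h

theorem mem_piece_self {n : ℕ} {w : ℂ} (h : w ∈ X.level n) : w ∈ X.piece n w :=
  mem_connectedComponentIn h

theorem mem_level_of_nonempty {n : ℕ} {x w : ℂ} (h : x ∈ X.piece n w) : w ∈ X.level n :=
  connectedComponentIn_nonempty_iff.mp ⟨x, h⟩

theorem piece_eq {n : ℕ} {x w : ℂ} (h : x ∈ X.piece n w) : X.piece n x = X.piece n w :=
  (connectedComponentIn_eq h).symm

theorem mem_piece_symm {n : ℕ} {x w : ℂ} (h : x ∈ X.piece n w) : w ∈ X.piece n x := by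
  rw [X.piece_eq h]
  exact X.mem_piece_self (X.mem_level_of_nonempty h)

theorem isOpen_piece (n : ℕ) (w : ℂ) : IsOpen (X.piece n w) := (X.isOpen_level n).connectedComponentIn

theorem isPreconnected_piece (n : ℕ) (w : ℂ) : IsPreconnected (X.piece n w) :=
  isPreconnected_connectedComponentIn

theorem piece_anti (w : ℂ) : Antitone fun n => X.piece n w :=
  fun _ _ h => connectedComponentIn_mono w (X.level_anti h)

theorem closure_dom_subset : closure X.dom ⊆ {w | w ∈ quadBasin X.c → ‖X.B w‖ ≤ X.ρ} :=
  closure_minimal (fun _ hw hb => (hw hb).le) (X.hB.isClosed_sublevel _)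

theorem piece_subset_dom (n : ℕ) (w : ℂ) : X.piece n w ⊆ X.dom :=
  (connectedComponentIn_subset _ _).trans (X.level_subset_dom n)

theorem isCompact_closure_piece (n : ℕ) (w : ℂ) : IsCompact (closure (X.piece n w)) :=
  (X.hB.isCompact_sublevel X.ρ).of_isClosed_subset isClosed_closure
    ((closure_mono (X.piece_subset_dom n w)).trans X.closure_dom_subset)

theorem mem_piece_of_mem_closure {n : ℕ} {x w : ℂ} (hx : x ∈ X.level n)
    (h : x ∈ closure (X.piece n w)) : x ∈ X.piece n w :=
  mem_connectedComponentIn_of_mem_closure (X.isOpen_level n) hx h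

theorem mapsTo_piece (n : ℕ) (w : ℂ) : MapsTo (quad X.c) (X.piece (n + 1) w) (X.piece n (quad X.c w)) := by
  intro x hx
  have hw := X.mem_level_of_nonempty hx
  have h := ((X.isPreconnected_piece (n + 1) w).image _ (continuous_quad X.c).continuousOn).subset_connectedComponentIn
    (F := X.level n) (mem_image_of_mem _ (X.mem_piece_self hw)) (by
      rintro _ ⟨y, hy, rfl⟩
      exact X.quad_mem_level_iff.mpr (X.mem_level_of_mem_piece hy))
  exact h (mem_image_of_mem _ hx)

theorem mapsTo_iterate_piece (k n : ℕ) (w : ℂ) :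
    MapsTo (quad X.c)^[k] (X.piece (n + k) w) (X.piece n ((quad X.c)^[k] w)) := by
  induction k generalizing w with
  | zero => exact mapsTo_id _
  | succ k ih =>
    intro x hx
    exact ih (quad X.c w) (X.mapsTo_piece (n + k) w hx)

/-- The image is open. It is also relatively closed: a point of the compact closure of the piece
that is sent into the level set of depth $n$ lies in the level set of depth $n+1$, hence in the
piece itself. -/
theorem image_piece {n : ℕ} {w : ℂ} (hw : w ∈ X.level (n + 1)) :
    quad X.c '' X.piece (n + 1) w = X.piece n (quad X.c w) := by
  refine Subset.antisymm (X.mapsTo_piece n w).image_subset ?_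
  apply (X.isPreconnected_piece n _).subset_of_closure_inter_subset
    (isOpenMap_quad _ _ (X.isOpen_piece _ _))
  · exact ⟨quad X.c w, X.mem_piece_self hw, mem_image_of_mem _ (X.mem_piece_self hw)⟩
  · rw [← image_closure_of_isCompact (X.isCompact_closure_piece _ _) (continuous_quad _).continuousOn]
    rintro _ ⟨⟨x, hx, rfl⟩, hx2⟩
    exact mem_image_of_mem _
      (X.mem_piece_of_mem_closure (X.quad_mem_level_iff.mp (X.mem_level_of_mem_piece hx2)) hx)

theorem image_closure_piece {n : ℕ} {w : ℂ} (hw : w ∈ X.level (n + 1)) :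
    quad X.c '' closure (X.piece (n + 1) w) = closure (X.piece n (quad X.c w)) := by
  rw [image_closure_of_isCompact (X.isCompact_closure_piece _ _) (continuous_quad _).continuousOn,
    X.image_piece hw]

end PolyPuzzle

/-! ### Regularity of puzzle pieces -/

namespace PolyPuzzle

variable (X : PolyPuzzle)

theorem bottcherRay_disjoint_cut {u : Circle} {T : Set Circle} (hu : u ∉ T) :
    Disjoint (bottcherRay X.c X.B u) (X.cut T) := by
  rw [disjoint_left]
  rintro x hx (⟨v, hv, hxv⟩ | hxa)
  · exact hu (IsBottcher.ray_unique hx hxv ▸ hv)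
  · rw [mem_singleton_iff.mp hxa] at hx
    exact X.a_notMem_basin hx.1

theorem inv_mem_dom {r : ℝ} (hr : 1 < r) (hr' : r < X.ρ) (u : Circle) :
    bottcherInv X.c X.B (r * u) ∈ X.dom := by
  intro _
  rwa [X.hB.apply_inv (one_lt_norm_ofReal_mul_circle hr u), norm_ofReal_mul_circle (by linarith)]

theorem inv_mem_level_iff {r : ℝ} (hr : 1 < r) {u : Circle} {n : ℕ} :
    bottcherInv X.c X.B (r * u) ∈ X.level n ↔ r ^ 2 ^ n < X.ρ ∧ u ^ 2 ^ n ∉ X.angles := by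
  have hrn : 1 < r ^ 2 ^ n := one_lt_pow₀ hr (by positivity)
  rw [level, mem_preimage, X.hB.quad_iterate_inv hr]
  constructor
  · rintro ⟨h1, h2⟩
    constructor
    · have := h1 (X.hB.inv_mem (one_lt_norm_ofReal_mul_circle hrn _))
      rwa [X.hB.apply_inv (one_lt_norm_ofReal_mul_circle hrn _),
        norm_ofReal_mul_circle (by linarith)] at this
    · exact fun h => h2 (Or.inl ⟨_, h, X.hB.inv_mem_ray hrn _⟩)
  · rintro ⟨h1, h2⟩
    exact ⟨X.inv_mem_dom hrn h1 _,
      disjoint_left.mp (X.bottcherRay_disjoint_cut h2) (X.hB.inv_mem_ray hrn _)⟩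

/-- For a ray landing at `a`, there is a square root of `w - a` on the equipotential domain cut
along this ray. -/
theorem exists_sqrt_dom {u : Circle} (hu : u ∈ X.angles) :
    ∃ s : ℂ → ℂ, ContinuousOn s (X.dom \ X.cut {u}) ∧ ∀ w ∈ X.dom \ X.cut {u}, s w ^ 2 = w - X.a := by
  obtain ⟨r, hr⟩ := X.hB.exists_sublevel_subset_ball X.ρ
  obtain ⟨R, hR, hRfar⟩ := X.hB.exists_far r
  refine exists_sqrt_of_joinedIn (b := bottcherInv X.c X.B (R * u)) ?_ ?_
  · intro w hw
    have := hr (fun hb => (hw.1 hb).le)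
    rw [mem_ball_zero_iff] at this
    exact this.trans (hRfar R le_rfl u)
  · refine (X.hB.joinedIn_ray (X.lands u hu) hR).mono ?_
    rintro x (rfl | hx) hx'
    · exact hx'.2 (Or.inr rfl)
    · exact hx'.2 (Or.inl ⟨u, rfl, hx⟩)

/-- The open sector of the equipotential domain with arguments in `Ioo s t`. -/
def sector (s t : ℝ) : Set ℂ :=
  (fun ζ => bottcherInv X.c X.B (Complex.exp ζ)) ''
    {ζ : ℂ | (0 < ζ.re ∧ ζ.re < Real.log X.ρ) ∧ (s < ζ.im ∧ ζ.im < t)}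

theorem isPreconnected_sector (s t : ℝ) : IsPreconnected (X.sector s t) := by
  refine X.hB.isPreconnected_image_exp ?_ fun ζ h => h.1.1
  exact (((convex_halfSpace_re_gt 0).inter (convex_halfSpace_re_lt _)).inter
    ((convex_halfSpace_im_gt s).inter (convex_halfSpace_im_lt t))).isPreconnected

theorem sector_eq (s t : ℝ) : X.sector s t = quadBasin X.c ∩ X.B ⁻¹' (Complex.exp ''
    {ζ : ℂ | (0 < ζ.re ∧ ζ.re < Real.log X.ρ) ∧ (s < ζ.im ∧ ζ.im < t)}) := by
  have h1 : ∀ ζ : ℂ, 0 < ζ.re → 1 < ‖Complex.exp ζ‖ := fun ζ h => by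
    rw [Complex.norm_exp]; exact Real.one_lt_exp_iff.mpr h
  ext w
  constructor
  · rintro ⟨ζ, hζ, rfl⟩
    exact ⟨X.hB.inv_mem (h1 ζ hζ.1.1), ζ, hζ, (X.hB.apply_inv (h1 ζ hζ.1.1)).symm⟩
  · rintro ⟨hw, ζ, hζ, h⟩
    exact ⟨ζ, hζ, (X.hB.eq_inv hw h.symm).symm⟩

theorem isOpen_sector (s t : ℝ) : IsOpen (X.sector s t) := by
  rw [sector_eq]
  apply X.hB.continuousOn.isOpen_inter_preimage (isOpen_quadBasin _)
  apply Complex.isOpenMap_exp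
  exact ((isOpen_lt continuous_const Complex.continuous_re).inter
    (isOpen_lt Complex.continuous_re continuous_const)).inter
    ((isOpen_lt continuous_const Complex.continuous_im).inter
    (isOpen_lt Complex.continuous_im continuous_const))

theorem mem_sector_iff {s t : ℝ} {w : ℂ} : w ∈ X.sector s t ↔ ∃ r θ : ℝ, 1 < r ∧ r < X.ρ ∧ s < θ ∧
    θ < t ∧ w = bottcherInv X.c X.B (r * Circle.exp θ) := by
  constructor
  · rintro ⟨ζ, ⟨⟨h1, h2⟩, h3, h4⟩, rfl⟩
    refine ⟨Real.exp ζ.re, ζ.im, Real.one_lt_exp_iff.mpr h1, ?_, h3, h4, ?_⟩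
    · rwa [← Real.lt_log_iff_exp_lt (by linarith [X.one_lt])]
    · simp only [exp_eq_ofReal_mul_circle]
  · rintro ⟨r, θ, h1, h2, h3, h4, rfl⟩
    refine ⟨⟨Real.log r, θ⟩, ⟨⟨Real.log_pos h1, Real.log_lt_log (by linarith) h2⟩, h3, h4⟩, ?_⟩
    simp only [exp_eq_ofReal_mul_circle, Real.exp_log (by linarith : 0 < r)]

/-- Both sides of a ray landing at `a` do not belong to the same piece of depth zero. -/
theorem disjoint_interior_closure_ray (w : ℂ) {u : Circle} (hu : u ∈ X.angles) :
    Disjoint (interior (closure (X.piece 0 w)) ∩ X.dom) (bottcherRay X.c X.B u) := by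
  rw [disjoint_left]
  rintro x ⟨hxI, hxd⟩ ⟨hxb, r, hr, hBx⟩
  have hxr : x = bottcherInv X.c X.B (r * u) := X.hB.eq_inv hxb hBx
  have hrρ : r < X.ρ := by
    have := hxd hxb
    rwa [hBx, norm_ofReal_mul_circle (by linarith)] at this
  set C := X.piece 0 w with hC
  set θ₀ := Complex.arg u
  have hθ₀ : Circle.exp θ₀ = u := Circle.exp_arg u
  -- The number $\delta$ separates $\theta_0$ from the other angles of the cut, so the sectors on
  -- both sides of the ray contain no rays of the cut.
  obtain ⟨δ, hδ, hδθ⟩ := Metric.mem_nhdsWithin_iff.mp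
    (eventually_circleExp_notMem X.finite_angles θ₀)
  have hδθ' : ∀ θ : ℝ, |θ - θ₀| < δ → θ ≠ θ₀ → Circle.exp θ ∉ X.angles := fun θ h1 h2 =>
    hδθ ⟨by rwa [Metric.mem_ball, Real.dist_eq], h2⟩
  -- a sector without rays having `x` in its closure lies in `C`
  have hside : ∀ s t : ℝ, (∀ θ, s < θ → θ < t → Circle.exp θ ∉ X.angles) →
      (interior (closure C) ∩ X.sector s t).Nonempty → X.sector s t ⊆ C := by
    rintro s t hst ⟨y, hyI, hyS⟩
    obtain ⟨y', hy'S, hy'C⟩ := mem_closure_iff.mp (interior_subset hyI) _ (X.isOpen_sector s t) hyS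
    have hsub : X.sector s t ⊆ X.level 0 := by
      intro v hv
      obtain ⟨r', θ, h1, h2, h3, h4, rfl⟩ := X.mem_sector_iff.mp hv
      rw [X.inv_mem_level_iff h1]
      simpa using ⟨h2, hst θ h3 h4⟩
    have h := (X.isPreconnected_sector s t).subset_connectedComponentIn hy'S hsub
    have h2 : X.piece 0 y' = C := X.piece_eq hy'C
    exact h2 ▸ h
  have hcontθ : ContinuousAt (fun θ : ℝ => bottcherInv X.c X.B (r * Circle.exp θ)) θ₀ := by
    have h1 := X.hB.continuousAt_inv (one_lt_norm_ofReal_mul_circle hr (Circle.exp θ₀))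
    exact ContinuousAt.comp (f := fun θ : ℝ => (r : ℂ) * Circle.exp θ) h1 (by fun_prop)
  have hevI : ∀ᶠ θ in 𝓝 θ₀, bottcherInv X.c X.B (r * Circle.exp θ) ∈ interior (closure C) := by
    apply hcontθ.eventually
    simp only [hθ₀, ← hxr]
    exact isOpen_interior.mem_nhds hxI
  have hright : X.sector θ₀ (θ₀ + δ) ⊆ C := by
    apply hside
    · intro θ h1 h2
      exact hδθ' θ (by rw [abs_of_pos (by linarith)]; linarith) h1.ne'
    · have h1 : ∀ᶠ θ in 𝓝[>] θ₀, θ < θ₀ + δ :=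
        eventually_nhdsWithin_of_eventually_nhds (eventually_lt_nhds (by linarith))
      obtain ⟨θ, h1, h2, h3⟩ := (h1.and ((hevI.filter_mono nhdsWithin_le_nhds).and
        (self_mem_nhdsWithin (a := θ₀) (s := Ioi θ₀)))).exists
      exact ⟨_, h2, X.mem_sector_iff.mpr ⟨r, θ, hr, hrρ, h3, h1, rfl⟩⟩
  have hleft : X.sector (θ₀ - δ) θ₀ ⊆ C := by
    apply hside
    · intro θ h1 h2
      exact hδθ' θ (by rw [abs_of_neg (by linarith)]; linarith) h2.ne
    · have h1 : ∀ᶠ θ in 𝓝[<] θ₀, θ₀ - δ < θ :=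
        eventually_nhdsWithin_of_eventually_nhds (eventually_gt_nhds (by linarith))
      obtain ⟨θ, h1, h2, h3⟩ := (h1.and ((hevI.filter_mono nhdsWithin_le_nhds).and
        (self_mem_nhdsWithin (a := θ₀) (s := Iio θ₀)))).exists
      exact ⟨_, h2, X.mem_sector_iff.mpr ⟨r, θ, hr, hrρ, h1, h3, rfl⟩⟩
  have hsector : ∀ v ∈ X.sector (θ₀ - δ) (θ₀ + δ), v ∈ bottcherRay X.c X.B u ∨ v ∈ C := by
    intro v hv
    obtain ⟨r', θ, h1, h2, h3, h4, rfl⟩ := X.mem_sector_iff.mp hv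
    rcases lt_trichotomy θ θ₀ with h | h | h
    · exact Or.inr (hleft (X.mem_sector_iff.mpr ⟨r', θ, h1, h2, h3, h, rfl⟩))
    · left
      rw [h, hθ₀]
      exact X.hB.inv_mem_ray h1 u
    · exact Or.inr (hright (X.mem_sector_iff.mpr ⟨r', θ, h1, h2, h, h4, rfl⟩))
  -- square roots of `w - a` cut along two different rays
  obtain ⟨u', hu', huu'⟩ := X.nontrivial_angles.exists_ne u
  obtain ⟨s₁, hs₁c, hs₁⟩ := X.exists_sqrt_dom hu
  obtain ⟨s₂, hs₂c, hs₂⟩ := X.exists_sqrt_dom hu'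
  have hCsub : ∀ v ∈ X.angles, C ⊆ X.dom \ X.cut {v} := by
    intro v hv y hy
    have hy' := X.mem_level_of_mem_piece hy
    refine ⟨hy'.1, ?_⟩
    rintro (⟨v', hv', hyv⟩ | hya)
    · exact hy'.2 (Or.inl ⟨v', by rwa [mem_singleton_iff.mp hv'], hyv⟩)
    · exact hy'.2 (Or.inr hya)
  have hne : ∀ y ∈ X.dom \ X.cut {u'}, s₂ y ≠ 0 := by
    intro y hy h0
    have := hs₂ y hy
    rw [h0, zero_pow two_ne_zero, eq_comm, sub_eq_zero] at this
    exact hy.2 (Or.inr this)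
  -- On the connected set $C$ the two roots agree up to sign. After a change of sign they agree on
  -- $C$, thus on both sides of the ray $u$.
  obtain ⟨s₃, hs₃c, hs₃, hs₁₃⟩ : ∃ s₃ : ℂ → ℂ, ContinuousOn s₃ (X.dom \ X.cut {u'}) ∧
      (∀ y ∈ X.dom \ X.cut {u'}, s₃ y ^ 2 = y - X.a) ∧ EqOn s₁ s₃ C := by
    have hsq : EqOn (s₁ ^ 2) (s₂ ^ 2) C := fun y hy => by
      simp only [Pi.pow_apply, hs₁ y (hCsub u hu hy), hs₂ y (hCsub u' hu' hy)]
    rcases (X.isPreconnected_piece 0 w).eq_or_eq_neg_of_sq_eq (hs₁c.mono (hCsub u hu))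
      (hs₂c.mono (hCsub u' hu')) hsq (fun {y} hy => hne y (hCsub u' hu' hy)) with h | h
    · exact ⟨s₂, hs₂c, hs₂, h⟩
    · exact ⟨-s₂, hs₂c.neg, fun y hy => by rw [Pi.neg_apply, neg_sq, hs₂ y hy], h⟩
  classical
  -- Off the ray $u$ this is the root cut along $u$; on that ray it takes the values of the root cut
  -- along $u'$. The agreement on both sides makes it continuous on the whole domain except at $a$.
  set s : ℂ → ℂ := fun y => if y ∈ bottcherRay X.c X.B u then s₃ y else s₁ y with hs
  have hopen : ∀ v ∈ X.angles, IsOpen (X.dom \ X.cut {v}) := fun v hv =>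
    X.isOpen_dom.sdiff (X.isClosed_cut (singleton_subset_iff.mpr hv))
  have hray : ∀ y ∈ bottcherRay X.c X.B u, y ∈ X.dom → y ∈ X.dom \ X.cut {u'} := fun y hy hyd =>
    ⟨hyd, disjoint_left.mp (X.bottcherRay_disjoint_cut (T := {u'}) (by simpa using huu'.symm)) hy⟩
  have hoff : ∀ y ∉ bottcherRay X.c X.B u, y ∈ X.dom → y ≠ X.a → y ∈ X.dom \ X.cut {u} := by
    intro y hy hyd hya
    refine ⟨hyd, ?_⟩
    rintro (⟨v, hv, hyv⟩ | h)
    · exact hy (mem_singleton_iff.mp hv ▸ hyv)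
    · exact hya h
  have hssq : ∀ y ∈ X.dom, y ≠ X.a → s y ^ 2 = y - X.a := by
    intro y hyd hya
    by_cases hy : y ∈ bottcherRay X.c X.B u
    · simp only [hs, if_pos hy]; exact hs₃ y (hray y hy hyd)
    · simp only [hs, if_neg hy]; exact hs₁ y (hoff y hy hyd hya)
  have hscont : ∀ y ∈ X.dom, y ≠ X.a → ContinuousAt s y := by
    intro y hyd hya
    by_cases hy : y ∈ bottcherRay X.c X.B u
    · have hyS : y ∈ X.sector (θ₀ - δ) (θ₀ + δ) := by
        obtain ⟨hyb, r', hr', hBy⟩ := hy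
        refine X.mem_sector_iff.mpr ⟨r', θ₀, hr', ?_, by linarith, by linarith, ?_⟩
        · have := hyd hyb
          rwa [hBy, norm_ofReal_mul_circle (by linarith)] at this
        · rw [hθ₀]; exact X.hB.eq_inv hyb hBy
      have h1 := hs₃c.continuousAt ((hopen u' hu').mem_nhds (hray y hy hyd))
      refine h1.congr ?_
      filter_upwards [(X.isOpen_sector _ _).mem_nhds hyS] with v hv
      by_cases hvr : v ∈ bottcherRay X.c X.B u
      · simp only [hs, if_pos hvr]
      · simp only [hs, if_neg hvr]
        exact (hs₁₃ ((hsector v hv).resolve_left hvr)).symm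
    · have h1 := hs₁c.continuousAt ((hopen u hu).mem_nhds (hoff y hy hyd hya))
      refine h1.congr ?_
      filter_upwards [(hopen u hu).mem_nhds (hoff y hy hyd hya)] with v hv
      have hvr : v ∉ bottcherRay X.c X.B u := fun h => hv.2 (Or.inl ⟨u, rfl, h⟩)
      simp only [hs, if_neg hvr]
  -- A small circle around $a$ now carries a continuous square root of $w-a$, which is impossible.
  obtain ⟨τ, hτ, hτd⟩ := Metric.isOpen_iff.mp X.isOpen_dom X.a X.a_mem_dom
  have hsph : ∀ y ∈ Metric.sphere X.a (τ / 2), y ∈ X.dom ∧ y ≠ X.a := by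
    intro y hy
    rw [mem_sphere_iff_norm] at hy
    refine ⟨hτd ?_, ?_⟩
    · rw [mem_ball_iff_norm]; linarith
    · rintro rfl
      rw [sub_self, norm_zero] at hy
      linarith
  exact not_continuousOn_sqrt_sphere (half_pos hτ)
    (fun y hy => (hscont y (hsph y hy).1 (hsph y hy).2).continuousWithinAt)
    (fun y hy => hssq y (hsph y hy).1 (hsph y hy).2)

/-- An interior point cannot be on the equipotential, since $B$ is open and nearby points would have
$|B|>\rho$. It cannot be on a ray of the cut, and therefore cannot be $a$ either, since rays
accumulate there. -/
theorem interior_closure_piece_zero_subset (w : ℂ) :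
    interior (closure (X.piece 0 w)) ⊆ X.level 0 := by
  have hdom : interior (closure (X.piece 0 w)) ⊆ X.dom := by
    intro x hx hb
    have hle := X.closure_dom_subset (closure_mono (X.piece_subset_dom 0 w) (interior_subset hx)) hb
    refine lt_of_le_of_ne hle fun heq => ?_
    have h1 := X.hB.nhds_le_map hb (image_mem_map (inter_mem (isOpen_interior.mem_nhds hx)
      ((isOpen_quadBasin _).mem_nhds hb)))
    have h2 : Tendsto (fun t : ℝ => (t : ℂ) * X.B x) (𝓝[>] 1) (𝓝 (X.B x)) := by
      have : Continuous fun t : ℝ => (t : ℂ) * X.B x := by fun_prop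
      simpa using (this.tendsto 1).mono_left nhdsWithin_le_nhds
    obtain ⟨t, ⟨y, ⟨hyI, hyb⟩, hyt⟩, ht⟩ := ((h2.eventually h1).and
      (self_mem_nhdsWithin (a := (1 : ℝ)) (s := Ioi 1))).exists
    have h3 := X.closure_dom_subset (closure_mono (X.piece_subset_dom 0 w) (interior_subset hyI)) hyb
    rw [hyt, norm_mul, Complex.norm_real, Real.norm_of_nonneg (by linarith [ht]), heq] at h3
    nlinarith [X.one_lt, ht]
  intro x hx
  refine ⟨hdom hx, ?_⟩
  rintro (⟨u, hu, hxu⟩ | hxa)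
  · exact disjoint_left.mp (X.disjoint_interior_closure_ray w hu) ⟨hx, hdom hx⟩ hxu
  · obtain rfl : x = X.a := hxa
    obtain ⟨u, hu⟩ := X.nontrivial_angles.nonempty
    obtain ⟨r, h1, h2⟩ := (((X.lands u hu).eventually (isOpen_interior.mem_nhds hx)).and
      (self_mem_nhdsWithin (a := (1 : ℝ)) (s := Ioi 1))).exists
    exact disjoint_left.mp (X.disjoint_interior_closure_ray w hu) ⟨h1, hdom h1⟩ (X.hB.inv_mem_ray h2 u)

/-- Puzzle pieces are regular: open pieces are the interiors of closed ones. -/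
theorem interior_closure_piece (n : ℕ) (w : ℂ) :
    interior (closure (X.piece n w)) = X.piece n w := by
  refine interior_closure_connectedComponentIn (X.isOpen_level n) ?_
  -- Openness of the iterate reduces depth $n$ to depth zero.
  have h1 : (quad X.c)^[n] '' interior (closure (X.piece n w)) ⊆
      interior (closure (X.piece 0 ((quad X.c)^[n] w))) := by
    apply interior_maximal _ (isOpenMap_quad_iterate _ n _ isOpen_interior)
    refine (image_mono interior_subset).trans
      ((image_closure_subset_closure_image (continuous_quad_iterate _ n)).trans (closure_mono ?_))
    have := X.mapsTo_iterate_piece n 0 w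
    rw [zero_add] at this
    exact this.image_subset
  intro x hx
  exact X.interior_closure_piece_zero_subset _ (h1 (mem_image_of_mem _ hx))

end PolyPuzzle

/-! ### Univalence on noncritical pieces -/

namespace PolyPuzzle

variable (X : PolyPuzzle)

theorem zero_notMem_basin : (0 : ℂ) ∉ quadBasin X.c := X.hB.zero_notMem_quadBasin

theorem quad_zero : quad X.c 0 = X.c := by simp [quad_apply]

theorem quad_eq_c_iff {x : ℂ} : quad X.c x = X.c ↔ x = 0 := by simp [quad_apply]

theorem c_notMem_basin : X.c ∉ quadBasin X.c := fun h =>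
  X.zero_notMem_basin (quad_mem_quadBasin_iff.mp (by rwa [X.quad_zero]))

/-- Every open piece contains points of the basin of infinity. -/
theorem piece_inter_basin_nonempty {n : ℕ} {w : ℂ} (hw : w ∈ X.level n) :
    (X.piece n w ∩ quadBasin X.c).Nonempty := by
  by_contra hcon
  rw [not_nonempty_iff_eq_empty] at hcon
  set Q := X.piece n w
  have hQb : Q ⊆ (quadBasin X.c)ᶜ := fun x hx hb => by
    have : x ∈ Q ∩ quadBasin X.c := ⟨hx, hb⟩
    rw [hcon] at this
    exact this
  set A := (quad X.c)^[n] ⁻¹' {X.a}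
  have hA : A.Finite := finite_quad_iterate_preimage _ (finite_singleton _) n
  -- Outside the basin the cuts remove only the finitely many points of $A$. A piece missing the
  -- basin would thus be clopen in the connected complement of $A$ and fill it, but this complement
  -- meets the basin.
  have hcl : closure Q ∩ Aᶜ ⊆ Q := by
    rintro x ⟨hx, hxA⟩
    have hxb : x ∉ quadBasin X.c :=
      closure_minimal hQb (isOpen_quadBasin _).isClosed_compl hx
    refine X.mem_piece_of_mem_closure ⟨fun hb => ?_, ?_⟩ hx
    · exact absurd ((quad_iterate_mem_quadBasin_iff n).mp hb) hxb
    · rintro (⟨u, _, hxu⟩ | hxa)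
      · exact hxb ((quad_iterate_mem_quadBasin_iff n).mp hxu.1)
      · exact hxA hxa
  have hwA : w ∈ Aᶜ := fun h => hw.2 (Or.inr h)
  have hAc : IsPreconnected Aᶜ :=
    (hA.countable.isConnected_compl_of_one_lt_rank (by simp)).isPreconnected
  have hsub := hAc.subset_of_closure_inter_subset (X.isOpen_piece n w)
    ⟨w, hwA, X.mem_piece_self hw⟩ hcl
  have hinf : (quadBasin X.c).Infinite := by
    intro hfin
    refine (infinite_of_mem_nhds ((‖X.c‖ + 2 : ℝ) : ℂ) ((isOpen_quadBasin _).mem_nhds ?_)) hfin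
    apply mem_quadBasin_of_le_norm
    rw [Complex.norm_real]
    exact Real.le_norm_self _
  obtain ⟨x, hx1, hx2⟩ := hinf.exists_notMem_finite hA
  exact hQb (hsub hx2) hx1

/-- A preimage of `a` is the landing point of a preimage of any ray landing at `a`. -/
theorem exists_landsAt_preimage {u : Circle} (hu : u ∈ X.angles) (n : ℕ) {x : ℂ}
    (hx : (quad X.c)^[n] x = X.a) :
    ∃ v : Circle, v ^ 2 ^ n = u ∧ BottcherRayLandsAt X.c X.B v x := by
  induction n generalizing x with
  | zero =>
    obtain rfl : x = X.a := hx
    exact ⟨u, by simp, X.lands u hu⟩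
  | succ n ih =>
    obtain ⟨v, hv, hvl⟩ := ih (x := quad X.c x) hx
    obtain ⟨v', hv', hvl'⟩ := X.hB.exists_ray_landsAt hvl
    exact ⟨v', by rw [pow_succ', pow_mul, hv', hv], hvl'⟩

/-- The critical value can be joined to points far away in the complement of a piece `Q` not
containing it, and of a given point of the boundary of `Q`. -/
theorem exists_joinedIn_compl {n : ℕ} {w y : ℂ} (hc : X.c ∉ X.piece n w)
    (hy : y ∈ closure (X.piece n w)) (hyc : y ≠ X.c) (M : ℝ) :
    ∃ b : ℂ, M < ‖b‖ ∧ JoinedIn (insert y (X.piece n w))ᶜ X.c b := by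
  obtain ⟨R, hR, hRfar⟩ := X.hB.exists_far M
  -- If $c$ lies in an open piece, the path stays in this piece up to a basin point and then goes
  -- out along a ray. Otherwise $c$ is an iterated preimage of $a$, and a ray landing at $c$ is
  -- followed.
  by_cases hcn : X.c ∈ X.level n
  · set Q := X.piece n X.c
    have hdisj : ∀ x ∈ Q, x ∉ X.piece n w := fun x h1 h2 => by
      apply hc
      rw [← X.piece_eq h2]
      exact X.mem_piece_symm h1
    have hyQ : ∀ x ∈ Q, x ∉ insert y (X.piece n w) := by
      rintro x hx (rfl | h)
      · obtain ⟨z, hz1, hz2⟩ := mem_closure_iff.mp hy _ (X.isOpen_piece n X.c) hx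
        exact hdisj z hz1 hz2
      · exact hdisj x hx h
    -- a point of `Q` whose ray does not contain `y`
    obtain ⟨e, heQ, heb, u, heu, hBe, hyu⟩ : ∃ e ∈ Q, e ∈ quadBasin X.c ∧ ∃ u : Circle,
        e ∈ bottcherRay X.c X.B u ∧ X.B e = ‖X.B e‖ * u ∧ y ∉ bottcherRay X.c X.B u := by
      obtain ⟨e, heQ, heb⟩ := X.piece_inter_basin_nonempty hcn
      obtain ⟨u, heu, hBe⟩ := X.hB.exists_mem_ray heb
      by_cases hyu : y ∈ bottcherRay X.c X.B u
      swap
      · exact ⟨e, heQ, heb, u, heu, hBe, hyu⟩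
      have he1 := X.hB.one_lt_norm heb
      set θ₀ := Complex.arg u
      have hθ₀ : Circle.exp θ₀ = u := Circle.exp_arg u
      have hcontθ : ContinuousAt
          (fun θ : ℝ => bottcherInv X.c X.B ((‖X.B e‖ : ℝ) * Circle.exp θ)) θ₀ := by
        have h1 := X.hB.continuousAt_inv (one_lt_norm_ofReal_mul_circle he1 (Circle.exp θ₀))
        exact ContinuousAt.comp (f := fun θ : ℝ => ((‖X.B e‖ : ℝ) : ℂ) * Circle.exp θ) h1
          (by fun_prop)
      have hev : ∀ᶠ θ in 𝓝 θ₀, bottcherInv X.c X.B ((‖X.B e‖ : ℝ) * Circle.exp θ) ∈ Q := by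
        apply hcontθ.eventually
        simp only [hθ₀, ← hBe, X.hB.inv_apply heb]
        exact (X.isOpen_piece _ _).mem_nhds heQ
      -- A slight rotation of $e$ in the Böttcher coordinate stays in the open set $Q$ and changes
      -- the ray.
      obtain ⟨θ, hθ1, hθ2⟩ := ((hev.filter_mono nhdsWithin_le_nhds).and
        (eventually_circleExp_notMem (finite_singleton u) θ₀)).exists
      have h1 := one_lt_norm_ofReal_mul_circle he1 (Circle.exp θ)
      refine ⟨_, hθ1, X.hB.inv_mem h1, Circle.exp θ, X.hB.inv_mem_ray he1 _, ?_, ?_⟩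
      · rw [X.hB.apply_inv h1, norm_ofReal_mul_circle (by linarith)]
      · exact fun h => hθ2 (IsBottcher.ray_unique h hyu)
    have he1 := X.hB.one_lt_norm heb
    have hRe : ‖X.B e‖ ≤ max R ‖X.B e‖ := le_max_right _ _
    refine ⟨bottcherInv X.c X.B ((max R ‖X.B e‖ : ℝ) * u), hRfar _ (le_max_left _ _) u, ?_⟩
    have hQpath : IsPathConnected Q := (X.isOpen_piece n X.c).isConnected_iff_isPathConnected.mp
      ⟨⟨_, X.mem_piece_self hcn⟩, X.isPreconnected_piece _ _⟩
    have hj1 : JoinedIn (insert y (X.piece n w))ᶜ X.c e :=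
      (hQpath.joinedIn _ (X.mem_piece_self hcn) _ heQ).mono hyQ
    have hee : bottcherInv X.c X.B ((‖X.B e‖ : ℝ) * u) = e := by rw [← hBe, X.hB.inv_apply heb]
    have hj2 := X.hB.joinedIn_subray (u := u) he1 hRe
    rw [hee] at hj2
    refine hj1.trans (hj2.mono ?_)
    rintro _ ⟨r, hr, rfl⟩ hmem
    have hr1 : 1 < r := he1.trans_le hr.1
    rcases hmem with h | h
    · exact hyu (h ▸ X.hB.inv_mem_ray hr1 u)
    · -- the part of the ray below a point of a piece lies in this piece
      have hrl := (X.inv_mem_level_iff hr1).mp (X.mem_level_of_mem_piece h)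
      have hpre : IsPreconnected ((fun s : ℝ => bottcherInv X.c X.B (s * u)) '' Icc ‖X.B e‖ r) :=
        isPreconnected_Icc.image _ ((X.hB.continuousOn_ray u).mono fun s hs => he1.trans_le hs.1)
      have hsub : ((fun s : ℝ => bottcherInv X.c X.B (s * u)) '' Icc ‖X.B e‖ r) ⊆ X.level n := by
        rintro _ ⟨s, hs, rfl⟩
        refine (X.inv_mem_level_iff (he1.trans_le hs.1)).mpr ⟨lt_of_le_of_lt ?_ hrl.1, hrl.2⟩
        exact pow_le_pow_left₀ (by linarith [hs.1]) hs.2 _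
      have hin := hpre.subset_connectedComponentIn
        (mem_image_of_mem _ (left_mem_Icc.mpr hr.1)) hsub
      have h4 := hin (mem_image_of_mem _ (right_mem_Icc.mpr hr.1))
      simp only [hee] at h4
      have h5 : X.piece n e = Q := X.piece_eq heQ
      exact hdisj _ (h5 ▸ h4) h
  · have hPc : (quad X.c)^[n] X.c = X.a := by
      have hb : (quad X.c)^[n] X.c ∉ quadBasin X.c := fun h =>
        X.c_notMem_basin ((quad_iterate_mem_quadBasin_iff n).mp h)
      by_contra hne
      refine hcn ⟨fun h => absurd h hb, ?_⟩
      rintro (⟨u, _, hu⟩ | h)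
      · exact hb hu.1
      · exact hne h
    -- Two distinct rays landing at $a$ lift to two distinct rays landing at $c$; the point $y$ lies
    -- on at most one of them.
    obtain ⟨v, hv, hvl, hyv⟩ : ∃ v : Circle, v ^ 2 ^ n ∈ X.angles ∧
        BottcherRayLandsAt X.c X.B v X.c ∧ y ∉ bottcherRay X.c X.B v := by
      obtain ⟨u₁, hu₁, u₂, hu₂, hne⟩ := X.nontrivial_angles
      obtain ⟨v₁, hv₁, hl₁⟩ := X.exists_landsAt_preimage hu₁ n hPc
      obtain ⟨v₂, hv₂, hl₂⟩ := X.exists_landsAt_preimage hu₂ n hPc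
      by_cases hy₁ : y ∈ bottcherRay X.c X.B v₁
      · refine ⟨v₂, by rwa [hv₂], hl₂, fun hy₂ => hne ?_⟩
        rw [← hv₁, ← hv₂, IsBottcher.ray_unique hy₁ hy₂]
      · exact ⟨v₁, by rwa [hv₁], hl₁, hy₁⟩
    refine ⟨bottcherInv X.c X.B (R * v), hRfar R le_rfl v, (X.hB.joinedIn_ray hvl hR).mono ?_⟩
    rintro x (rfl | hx) (h | h)
    · exact hyc h.symm
    · exact hc h
    · exact hyv (h ▸ hx)
    · obtain ⟨hxb, r, hr, hBx⟩ := hx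
      have h1 := X.mem_level_of_mem_piece h
      rw [X.hB.eq_inv hxb hBx, X.inv_mem_level_iff hr] at h1
      exact h1.2 hv

/-- The map is injective on closed pieces which do not contain the critical point inside. -/
theorem injOn_closure_piece {n : ℕ} {w : ℂ} (hw : w ∈ X.level (n + 1))
    (h0 : (0 : ℂ) ∉ X.piece (n + 1) w) : InjOn (quad X.c) (closure (X.piece (n + 1) w)) := by
  set Q := X.piece (n + 1) w
  have hc : X.c ∉ X.piece n (quad X.c w) := by
    rw [← X.image_piece hw]
    rintro ⟨x, hx, hxc⟩
    rw [X.quad_eq_c_iff] at hxc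
    exact h0 (hxc ▸ hx)
  intro x hx x' hx' hxx'
  rcases quad_eq_quad_iff.mp hxx'.symm with h | hneg
  · exact h.symm
  by_contra hne
  have hx0 : x ≠ 0 := by
    rintro rfl
    exact hne (by simp [hneg])
  have hy : quad X.c x ∈ closure (X.piece n (quad X.c w)) := by
    rw [← X.image_closure_piece hw]
    exact mem_image_of_mem _ hx
  have hyc : quad X.c x ≠ X.c := by
    rw [Ne, X.quad_eq_c_iff]
    exact hx0
  obtain ⟨r, hr⟩ := X.hB.exists_sublevel_subset_ball X.ρ
  obtain ⟨b, hb, hj⟩ := X.exists_joinedIn_compl hc hy hyc r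
  -- The root of $w-c$ is needed at the common image of $x$ and $x'=-x$ too, which may be on the
  -- boundary of the image piece.
  obtain ⟨s, hsc, hs⟩ := exists_sqrt_of_joinedIn (S := insert (quad X.c x) (X.piece n (quad X.c w)))
    (by
      intro v hv
      have hv' : v ∈ closure X.dom := by
        rcases hv with rfl | hv
        · exact closure_mono (X.piece_subset_dom _ _) hy
        · exact subset_closure (X.piece_subset_dom _ _ hv)
      have := hr (X.closure_dom_subset hv')
      rw [mem_ball_zero_iff] at this
      exact this.trans hb) hj
  have hmaps : MapsTo (quad X.c) (Q ∪ {x, x'}) (insert (quad X.c x) (X.piece n (quad X.c w))) := by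
    rintro v (hv | rfl | rfl)
    · exact Or.inr (X.mapsTo_piece n w hv)
    · exact Or.inl rfl
    · exact Or.inl hxx'.symm
  have hpre : IsPreconnected (Q ∪ {x, x'}) := by
    refine (X.isPreconnected_piece (n + 1) w).subset_closure subset_union_left
      (union_subset subset_closure ?_)
    rintro v (rfl | rfl)
    · exact hx
    · exact hx'
  -- On a connected set containing $x$ and $x'$, the identity and $s\circ P$, where $P$ is the
  -- polynomial, have the same square $v^2$, so they agree up to one sign. But $s\circ P$ takes
  -- equal values at $x$ and $x'$.
  have hsq : EqOn (id ^ 2) ((s ∘ quad X.c) ^ 2) (Q ∪ {x, x'}) := by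
    intro v hv
    simp only [Pi.pow_apply, id, Function.comp_apply]
    rw [hs _ (hmaps hv), quad_apply, add_sub_cancel_right]
  have hne0 : ∀ {v : ℂ}, v ∈ Q ∪ {x, x'} → (s ∘ quad X.c) v ≠ 0 := by
    intro v hv h
    have h1 := hsq hv
    simp only [Pi.pow_apply, id, h, zero_pow two_ne_zero] at h1
    have h2 : v = 0 := pow_eq_zero_iff two_ne_zero |>.mp h1
    rcases hv with hv | rfl | rfl
    · exact h0 (h2 ▸ hv)
    · exact hx0 h2
    · rw [h2, zero_eq_neg] at hneg
      exact hx0 hneg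
  have hxm : x ∈ Q ∪ {x, x'} := Or.inr (Or.inl rfl)
  have hxm' : x' ∈ Q ∪ {x, x'} := Or.inr (Or.inr rfl)
  rcases hpre.eq_or_eq_neg_of_sq_eq continuousOn_id
    (hsc.comp (continuous_quad _).continuousOn hmaps) hsq hne0 with h | h
  · have h1 := h hxm
    have h2 := h hxm'
    simp only [id, Function.comp_apply, ← hxx'] at h1 h2
    exact hne (h1.trans h2.symm)
  · have h1 := h hxm
    have h2 := h hxm'
    simp only [id, Function.comp_apply, Pi.neg_apply, ← hxx'] at h1 h2
    exact hne (h1.trans h2.symm)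

theorem bijOn_closure_piece {n : ℕ} {w : ℂ} (hw : w ∈ X.level (n + 1))
    (h0 : (0 : ℂ) ∉ X.piece (n + 1) w) :
    BijOn (quad X.c) (closure (X.piece (n + 1) w)) (closure (X.piece n (quad X.c w))) := by
  rw [← X.image_closure_piece hw]
  exact (X.injOn_closure_piece hw h0).bijOn_image

theorem bijOn_piece {n : ℕ} {w : ℂ} (hw : w ∈ X.level (n + 1)) (h0 : (0 : ℂ) ∉ X.piece (n + 1) w) :
    BijOn (quad X.c) (X.piece (n + 1) w) (X.piece n (quad X.c w)) := by
  rw [← X.image_piece hw]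
  exact ((X.injOn_closure_piece hw h0).mono subset_closure).bijOn_image

/-- A pull-back none of whose pieces is critical is univalent. -/
theorem bijOn_iterate {n : ℕ} (l : ℕ) {w : ℂ} (hw : w ∈ X.level (n + l))
    (h0 : ∀ j < l, (0 : ℂ) ∉ X.piece (n + (l - j)) ((quad X.c)^[j] w)) :
    BijOn (quad X.c)^[l] (closure (X.piece (n + l) w)) (closure (X.piece n ((quad X.c)^[l] w))) ∧
    BijOn (quad X.c)^[l] (X.piece (n + l) w) (X.piece n ((quad X.c)^[l] w)) := by
  induction l generalizing w with
  | zero => exact ⟨bijOn_id _, bijOn_id _⟩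
  | succ l ih =>
    have h1 := h0 0 (Nat.succ_pos l)
    have h2 := ih (w := quad X.c w) (X.quad_mem_level_iff.mpr hw) (fun j hj => by
      have h3 := h0 (j + 1) (by omega)
      rwa [Nat.add_sub_add_right] at h3)
    exact ⟨h2.1.comp (X.bijOn_closure_piece hw h1), h2.2.comp (X.bijOn_piece hw h1)⟩

/-- Pulling back a smaller piece by a noncritical step. -/
theorem mem_piece_of_quad_mem {n n' : ℕ} (hn : n ≤ n') {x w : ℂ} (h0 : (0 : ℂ) ∉ X.piece (n + 1) w)
    (hx : x ∈ X.piece (n + 1) w) (hx' : quad X.c x ∈ X.piece n' (quad X.c w)) :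
    x ∈ X.piece (n' + 1) w := by
  have hw' : w ∈ X.level (n' + 1) := X.quad_mem_level_iff.mp (X.mem_level_of_nonempty hx')
  rw [← X.image_piece hw'] at hx'
  obtain ⟨y, hy, hyx⟩ := hx'
  have hy' : y ∈ X.piece (n + 1) w := X.piece_anti w (by omega : n + 1 ≤ n' + 1) hy
  have := X.injOn_closure_piece (X.mem_level_of_nonempty hx) h0 (subset_closure hy')
    (subset_closure hx) hyx
  exact this ▸ hy

theorem mem_piece_of_iterate_mem {n n' : ℕ} (hn : n ≤ n') (k : ℕ) {x w : ℂ}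
    (h0 : ∀ j < k, (0 : ℂ) ∉ X.piece (n + (k - j)) ((quad X.c)^[j] w))
    (hx : x ∈ X.piece (n + k) w) (hx' : (quad X.c)^[k] x ∈ X.piece n' ((quad X.c)^[k] w)) :
    x ∈ X.piece (n' + k) w := by
  induction k generalizing x w with
  | zero => exact hx'
  | succ k ih =>
    refine X.mem_piece_of_quad_mem (n := n + k) (n' := n' + k) (by omega) (h0 0 (Nat.succ_pos k)) hx ?_
    refine ih (fun j hj => ?_) (X.mapsTo_piece _ _ hx) hx'
    have h3 := h0 (j + 1) (by omega)
    rwa [Nat.add_sub_add_right] at h3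

/-- The preimage of a piece around the critical value is connected. -/
theorem mem_piece_zero_of_quad_mem {n : ℕ} {x : ℂ} (hx : quad X.c x ∈ X.piece n X.c) :
    x ∈ X.piece (n + 1) 0 := by
  have hxl : x ∈ X.level (n + 1) := X.quad_mem_level_iff.mp (X.mem_level_of_mem_piece hx)
  -- The piece around $x$ maps onto a piece containing $c$, and the only preimage of $c$ is $0$.
  have h1 := X.mem_piece_symm hx
  rw [← X.image_piece hxl] at h1
  obtain ⟨y, hy, hyc⟩ := h1
  rw [X.quad_eq_c_iff] at hyc
  exact X.mem_piece_symm (hyc ▸ hy)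

/-! ### Central cascades -/

section Cascade

-- The piece of depth $d+ir$ around $0$ plays the role of $V^{m+i}$, and $r$ is the common return
-- time.
variable {d r N : ℕ} (hr : 0 < r) (hN : 1 ≤ N)
  (hret : (quad X.c)^[r] 0 ∈ X.piece (d + (N - 1) * r) 0)
  (hfirst : ∀ j, 0 < j → j < r → (quad X.c)^[j] 0 ∉ X.piece d 0)
include hr hN hret hfirst

omit hN in
/-- The return map of the cascade pulls the `i`-th piece back to the next one. -/
theorem cascade_pullback {i : ℕ} (hi : i ≤ N - 1) {x : ℂ} (hx : x ∈ X.piece (d + r) 0)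
    (hx' : (quad X.c)^[r] x ∈ X.piece (d + i * r) 0) : x ∈ X.piece (d + (i + 1) * r) 0 := by
  -- The return map is one critical step from $0$ to $c$ followed by $q$ noncritical steps; each
  -- kind is pulled back separately.
  obtain ⟨q, rfl⟩ : ∃ q, r = q + 1 := ⟨r - 1, by omega⟩
  have hret' : (quad X.c)^[q + 1] 0 ∈ X.piece (d + i * (q + 1)) 0 :=
    X.piece_anti 0 (by gcongr) hret
  rw [Function.iterate_succ_apply, X.quad_zero] at hret'
  rw [Function.iterate_succ_apply] at hx'
  rw [← X.piece_eq hret'] at hx'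
  have hstep : quad X.c x ∈ X.piece (d + i * (q + 1) + q) X.c := by
    -- A critical piece among these $q$ steps would make $0$ return to the piece of depth $d$ at a
    -- time $j+1<r$.
    refine X.mem_piece_of_iterate_mem (n := d) (by omega) q (fun j hj h => ?_) ?_ hx'
    · refine hfirst (j + 1) (by omega) (by omega) ?_
      rw [Function.iterate_succ_apply, X.quad_zero]
      exact X.piece_anti 0 (by omega) (X.mem_piece_symm h)
    · have := X.mapsTo_piece (d + q) 0 hx
      rwa [X.quad_zero] at this
  have := X.mem_piece_zero_of_quad_mem hstep
  have e : d + i * (q + 1) + q + 1 = d + (i + 1) * (q + 1) := by ring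
  rwa [e] at this

/-- Induction on $k$ in steps of $r$. If $0<k<r$, the points $0$ and $x$ reach the same piece of
depth $d$ at time $k$, an early return of $0$. If $k\ge r$, then $f^r(x)$ lies in the piece of depth
$d+k-r$ around $f^r(0)$, which is also the piece around $0$ because $k-r\le(N-1)r$. -/
theorem cascade_mem {k : ℕ} (hk : k ≤ N * r) {x : ℂ} (hx : x ∈ X.piece (d + k) 0)
    (hx' : (quad X.c)^[k] x ∈ X.piece (d + N * r) 0) : x ∈ X.piece (d + N * r) 0 := by
  induction k using Nat.strong_induction_on generalizing x with
  | _ k ih =>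
    rcases Nat.eq_zero_or_pos k with rfl | hk0
    · exact hx'
    rcases lt_or_ge k r with hkr | hkr
    · exfalso
      refine hfirst k hk0 hkr ?_
      have h1 := X.mapsTo_iterate_piece k d 0 hx
      have h2 : (quad X.c)^[k] x ∈ X.piece d 0 := X.piece_anti 0 (by omega) hx'
      rw [← X.piece_eq h2]
      exact X.mem_piece_symm h1
    · obtain ⟨k', rfl⟩ := Nat.exists_eq_add_of_le' hkr
      have hNr : N * r = (N - 1) * r + r := by
        obtain ⟨N', rfl⟩ := Nat.exists_eq_add_of_le' hN
        simp; ring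
      have h1 : (quad X.c)^[r] x ∈ X.piece (d + k') 0 := by
        have h2 := X.mapsTo_iterate_piece r (d + k') 0 (by rwa [add_assoc])
        rwa [X.piece_eq (X.piece_anti 0 (by omega : d + k' ≤ d + (N - 1) * r) hret)] at h2
      have h3 := ih k' (by omega) (by omega) h1 (by rwa [← Function.iterate_add_apply])
      have h4 := X.cascade_pullback hr hret hfirst le_rfl
        (X.piece_anti 0 (by omega : d + r ≤ d + (k' + r)) hx)
        (X.piece_anti 0 (by rw [hNr]; omega : d + (N - 1) * r ≤ d + N * r) h3)
      rwa [Nat.sub_add_cancel hN] at h4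

/-- The pull-back of the first piece of a central cascade along an orbit up to the first visit of
the last piece is univalent. -/
theorem cascade_bijOn {l : ℕ} {w : ℂ} (hl : (quad X.c)^[l] w ∈ X.piece (d + N * r) 0)
    (hmin : ∀ j < l, (quad X.c)^[j] w ∉ X.piece (d + N * r) 0) :
    BijOn (quad X.c)^[l] (closure (X.piece (d + l) w)) (closure (X.piece d 0)) ∧
    BijOn (quad X.c)^[l] (X.piece (d + l) w) (X.piece d 0) := by
  have hld : (quad X.c)^[l] w ∈ X.piece d 0 := X.piece_anti 0 (by omega) hl
  rw [← X.piece_eq hld]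
  refine X.bijOn_iterate l (X.quad_iterate_mem_level_iff.mp (X.mem_level_of_mem_piece hld))
    fun j hj h => hmin j hj ?_
  -- A critical piece in the pull-back puts the $j$-th orbit point in the piece of depth $d+(l-j)$
  -- around $0$; this yields a visit of the last piece before time $l$.
  have hx := X.mem_piece_symm h
  have hxl : (quad X.c)^[l - j] ((quad X.c)^[j] w) ∈ X.piece (d + N * r) 0 := by
    rwa [← Function.iterate_add_apply, Nat.sub_add_cancel hj.le]
  rcases le_total (l - j) (N * r) with hle | hle
  · exact X.cascade_mem hr hN hret hfirst hle hx hxl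
  · exact X.piece_anti 0 (by omega) hx

end Cascade

end PolyPuzzle

/-! ### Closures, interiors and components under a partial homeomorphism -/

namespace OpenPartialHomeomorph

variable {E E' : Type*} [TopologicalSpace E] [TopologicalSpace E'] (h : OpenPartialHomeomorph E E')

theorem closure_image_symm [T2Space E] {S : Set E'} (hc : IsCompact (closure S))
    (hS : closure S ⊆ h.target) : closure (h.symm '' S) = h.symm '' closure S :=
  (image_closure_of_isCompact hc (h.continuousOn_symm.mono hS)).symm

theorem interior_image_symm {T : Set E'} (hT : T ⊆ h.target) :
    interior (h.symm '' T) = h.symm '' interior T := by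
  apply Subset.antisymm
  · intro z hz
    obtain ⟨w, hw, rfl⟩ := interior_subset hz
    refine ⟨w, ?_, rfl⟩
    have hsub : interior (h.symm '' T) ⊆ h.source := by
      refine interior_subset.trans ?_
      rintro _ ⟨v, hv, rfl⟩
      exact h.map_target (hT hv)
    have himg : h '' interior (h.symm '' T) ⊆ T := by
      rintro _ ⟨_, hy, rfl⟩
      obtain ⟨v, hv, rfl⟩ := interior_subset hy
      rwa [h.right_inv (hT hv)]
    refine interior_maximal himg (h.isOpen_image_of_subset_source isOpen_interior hsub) ⟨_, hz, ?_⟩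
    exact h.right_inv (hT hw)
  · exact interior_maximal (image_mono interior_subset)
      (h.isOpen_image_symm_of_subset_target isOpen_interior (interior_subset.trans hT))

theorem connectedComponentIn_image_symm {S : Set E'} (hS : S ⊆ h.target) {w : E'} (hw : w ∈ S) :
    connectedComponentIn (h.symm '' S) (h.symm w) = h.symm '' connectedComponentIn S w := by
  apply Subset.antisymm
  · intro z hz
    have hsub : h.symm '' S ⊆ h.source := by
      rintro _ ⟨v, hv, rfl⟩
      exact h.map_target (hS hv)
    have h1 := (h.continuousOn.mono hsub).image_connectedComponentIn_subset
      (mem_image_of_mem _ hw) (mem_image_of_mem _ hz)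
    have h2 : h '' (h.symm '' S) = S := h.toPartialEquiv.symm.symm_image_image_of_subset_source hS
    rw [h2, h.right_inv (hS hw)] at h1
    exact ⟨h z, h1, h.left_inv (hsub (connectedComponentIn_subset _ _ hz))⟩
  · exact (h.continuousOn_symm.mono hS).image_connectedComponentIn_subset hw

end OpenPartialHomeomorph

/-! ### Preimages of pieces and orbits of closed pieces -/

namespace PolyPuzzle

variable (X : PolyPuzzle)

theorem preimage_iterate_subset_dom {S : Set ℂ} (hS : S ⊆ X.dom) (n : ℕ) :
    (quad X.c)^[n] ⁻¹' S ⊆ X.dom := by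
  induction n generalizing S with
  | zero => exact hS
  | succ n ih =>
    rw [Function.iterate_succ', preimage_comp]
    exact ih fun x hx => X.mem_dom_of_quad_mem (hS hx)

theorem connectedComponentIn_preimage_piece {d n : ℕ} {w w₀ : ℂ}
    (hw : (quad X.c)^[n] w ∈ X.piece d w₀) :
    connectedComponentIn ((quad X.c)^[n] ⁻¹' X.piece d w₀) w = X.piece (d + n) w := by
  apply Subset.antisymm
  · refine connectedComponentIn_mono w fun x hx => ?_
    exact X.quad_iterate_mem_level_iff.mp (X.mem_level_of_mem_piece hx)
  · apply (X.isPreconnected_piece _ _).subset_connectedComponentIn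
    · exact X.mem_piece_self (X.quad_iterate_mem_level_iff.mp (X.mem_level_of_mem_piece hw))
    · rw [← X.piece_eq hw]
      exact X.mapsTo_iterate_piece n d w

/-- Passes from closed to open pieces: a point with a later iterate off the cuts is itself off the
cuts, so it is not a boundary point. -/
theorem mem_piece_of_iterate_mem_level {n k : ℕ} {x w : ℂ} (hx : x ∈ closure (X.piece n w))
    (hk : (quad X.c)^[k] x ∈ X.level n) : x ∈ X.piece n w :=
  X.mem_piece_of_mem_closure
    (X.level_anti (Nat.le_add_right n k) (X.quad_iterate_mem_level_iff.mp hk)) hx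

/-- The next iterate still satisfies $|B|\le\rho$, so this one has $|B|\le\sqrt\rho<\rho$. Orbits of
boundary points thus stay in the open domain where the conjugacy is available. -/
theorem iterate_mem_dom_of_mem_closure {n l j : ℕ} (hj : j < l) {x w : ℂ}
    (hx : x ∈ closure (X.piece (n + l) w)) : (quad X.c)^[j] x ∈ X.dom := by
  have h1 : (quad X.c)^[j + 1] x ∈ closure X.dom := by
    refine closure_mono ?_ (image_closure_subset_closure_image (continuous_quad_iterate _ (j + 1))
      (mem_image_of_mem _ hx))
    have e : n + l = n + (l - (j + 1)) + (j + 1) := by omega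
    rw [e]
    exact (X.mapsTo_iterate_piece (j + 1) _ w).image_subset.trans (X.piece_subset_dom _ _)
  intro hb
  have h2 := X.closure_dom_subset h1
  rw [Function.iterate_succ_apply'] at h2
  have h3 := h2 (quad_mem_quadBasin_iff.mpr hb)
  rw [X.hB.map_quad hb, norm_pow] at h3
  by_contra! hcon
  nlinarith [X.one_lt]

end PolyPuzzle

/-! ### Landing rays in terms of the inverse Böttcher function -/

theorem RayLandsAt.bottcherRayLandsAt {c a : ℂ} {u : Circle} (hB : IsBottcher c (bottcher c))
    (h : RayLandsAt c u a) : BottcherRayLandsAt c (bottcher c) u a := by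
  obtain ⟨γ, hγ, hlim⟩ := h
  refine hlim.congr' ?_
  filter_upwards [self_mem_nhdsWithin] with r hr
  exact hB.eq_inv (hγ r hr).1 (hγ r hr).2

/-- The default value $0$ of `bottcher` is never $ru$, so a ray exists only if a Böttcher function
does. -/
theorem RayLandsAt.isBottcher {c a : ℂ} {u : Circle} (h : RayLandsAt c u a) :
    IsBottcher c (bottcher c) := by
  obtain ⟨γ, hγ, -⟩ := h
  by_cases hex : ∃ B, IsBottcher c B
  · rw [bottcher, dif_pos hex]
    exact hex.choose_spec
  · have h1 := (hγ 2 one_lt_two).2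
    rw [bottcher, dif_neg hex] at h1
    have h2 : ((2 : ℝ) : ℂ) * (u : ℂ) ≠ 0 := mul_ne_zero (by norm_num) (Circle.coe_ne_zero u)
    exact absurd h1.symm h2

/-- The point of radius $r$ on the ray $u^2$ is the image of the point of radius $\sqrt r$ on the
ray $u$, and the landing point is fixed. -/
theorem RayLandsAt.sq {c a : ℂ} {u : Circle} (h : RayLandsAt c u a) (ha : quad c a = a) :
    RayLandsAt c (u ^ 2) a := by
  have hB := h.isBottcher
  have h1 : Tendsto (fun r : ℝ => bottcherInv c (bottcher c) (r * u)) (𝓝[>] 1) (𝓝 a) :=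
    h.bottcherRayLandsAt hB
  refine ⟨fun r => bottcherInv c (bottcher c) (r * (u ^ 2 : Circle)), fun r hr => ?_, ?_⟩
  · have h2 := one_lt_norm_ofReal_mul_circle hr (u ^ 2)
    exact ⟨hB.inv_mem h2, hB.apply_inv h2⟩
  · have h2 : Tendsto Real.sqrt (𝓝[>] 1) (𝓝[>] 1) := by
      rw [tendsto_nhdsWithin_iff]
      constructor
      · simpa using (Real.continuous_sqrt.tendsto 1).mono_left nhdsWithin_le_nhds
      · filter_upwards [self_mem_nhdsWithin] with r hr
        exact Real.lt_sqrt_of_sq_lt (by simpa using hr)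
    have h3 := ((continuous_quad c).tendsto a).comp (h1.comp h2)
    rw [ha] at h3
    refine h3.congr' ?_
    filter_upwards [self_mem_nhdsWithin] with r hr
    have hr' : 1 < √r := Real.lt_sqrt_of_sq_lt (by simpa using hr)
    simp only [Function.comp_apply]
    rw [hB.quad_inv (one_lt_norm_ofReal_mul_circle hr' u), mul_pow, ← Complex.ofReal_pow,
      Real.sq_sqrt (by linarith [mem_Ioi.mp hr])]
    rfl

/-! ### Iterates and fibers of quadratic-like maps -/

namespace QuadraticLikeMap

variable (F : QuadraticLikeMap)

theorem mem_iterPreimage_succ {n : ℕ} {S : Set ℂ} {z : ℂ} :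
    z ∈ F.iterPreimage (n + 1) S ↔ z ∈ F.dom ∩ F.f ⁻¹' F.iterPreimage n S := by
  constructor
  · rintro ⟨h1, h2⟩
    exact ⟨h1 0 (Nat.succ_pos n), fun k hk => h1 (k + 1) (by omega), h2⟩
  · rintro ⟨h0, h1, h2⟩
    refine ⟨fun k hk => ?_, h2⟩
    rcases k with _ | k
    · exact h0
    · exact h1 k (by omega)

theorem iterPreimage_mono {n : ℕ} {S T : Set ℂ} (h : S ⊆ T) :
    F.iterPreimage n S ⊆ F.iterPreimage n T := fun _ hz => ⟨hz.1, h hz.2⟩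

theorem isOpen_dom : IsOpen F.dom := F.disk_dom.1

theorem differentiableOn_iterate {S : Set ℂ} (l : ℕ) (hS : ∀ k < l, MapsTo F.f^[k] S F.dom) :
    DifferentiableOn ℂ F.f^[l] S := by
  induction l with
  | zero => exact differentiableOn_id
  | succ l ih =>
    rw [Function.iterate_succ']
    exact F.holo.comp (ih fun k hk => hS k (by omega)) (hS l (by omega))

theorem finite_fiber {w : ℂ} (hw : w ∈ F.ran) : (F.dom ∩ F.f ⁻¹' {w}).Finite := by
  by_cases h : w = F.f 0
  · rw [h, F.fiber_crit]
    exact finite_singleton 0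
  · exact finite_of_ncard_ne_zero (by rw [F.fiber w hw h]; norm_num)

theorem nhds_le_map {z : ℂ} (hz : z ∈ F.dom) : 𝓝 (F.f z) ≤ map F.f (𝓝 z) :=
  nhds_le_map_nhds_of_finite_fiber F.isOpen_dom hz F.holo (F.finite_fiber (F.mapsTo hz))

end QuadraticLikeMap

/-! ### Transfer of the puzzle by the conjugacy -/

namespace YoccozPuzzle

variable {F : QuadraticLikeMap} (P : YoccozPuzzle F)

theorem α_mem_source : P.α ∈ P.h.source := by
  apply P.filledJulia_subset
  intro n
  rw [Function.iterate_fixed P.α_fixed]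
  exact P.α_mem

theorem quad_hα : quad P.c (P.h P.α) = P.h P.α := by
  have h1 := P.conj P.α P.α_mem_source (by rw [P.α_fixed]; exact P.α_mem_source)
  rw [P.α_fixed] at h1
  exact h1.symm

theorem isBottcher : IsBottcher P.c (bottcher P.c) :=
  P.dividing.nonempty.some_mem.isBottcher

/-- The puzzle of the quadratic polynomial. -/
noncomputable def poly (hfin : (landingAngles P.c (P.h P.α)).Finite) : PolyPuzzle where
  c := P.c
  B := bottcher P.c
  hB := P.isBottcher
  a := P.h P.α
  fixed := P.quad_hα
  angles := landingAngles P.c (P.h P.α)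
  finite_angles := hfin
  nontrivial_angles := P.dividing
  lands _ hu := RayLandsAt.bottcherRayLandsAt P.isBottcher hu
  sq_mem _ hu := RayLandsAt.sq hu P.quad_hα
  ρ := Real.exp P.η
  one_lt := Real.one_lt_exp_iff.mpr P.η_pos

variable (hfin : (landingAngles P.c (P.h P.α)).Finite)

/-- The polynomial squares $|B|$, which explains the level $e^{2\eta}$ in `η_small`. -/
theorem quad_mem_target {w : ℂ} (hw : w ∈ closure (P.poly hfin).dom) : quad P.c w ∈ P.h.target := by
  apply P.η_small
  intro hb
  have hb' := quad_mem_quadBasin_iff.mp hb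
  have h1 : ‖bottcher P.c w‖ ≤ Real.exp P.η := (P.poly hfin).closure_dom_subset hw hb'
  rw [P.isBottcher.map_quad hb', norm_pow, two_mul, Real.exp_add, ← sq]
  gcongr

theorem closure_dom_subset_target : closure (P.poly hfin).dom ⊆ P.h.target := by
  intro w hw
  apply P.η_small
  intro hb
  refine ((P.poly hfin).closure_dom_subset hw hb).trans ?_
  change Real.exp P.η ≤ _
  gcongr
  linarith [P.η_pos]

theorem dom_subset_target : (P.poly hfin).dom ⊆ P.h.target :=
  subset_closure.trans (P.closure_dom_subset_target hfin)

/-- The conjugacy holds on the whole domain bounded by the equipotential. -/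
theorem f_symm {w : ℂ} (hw : w ∈ (P.poly hfin).dom) :
    F.f (P.h.symm w) = P.h.symm (quad P.c w) := by
  set D := (P.poly hfin).dom with hD
  have hDt := P.dom_subset_target hfin
  have hDo : IsOpen D := (P.poly hfin).isOpen_dom
  have hmaps : MapsTo P.h.symm D F.dom := fun x hx => P.source_subset (P.h.map_target (hDt hx))
  have hc1 : ContinuousOn (fun x => F.f (P.h.symm x)) D :=
    F.holo.continuousOn.comp (P.h.continuousOn_symm.mono hDt) hmaps
  have hc2 : ContinuousOn (fun x => P.h.symm (quad P.c x)) D :=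
    P.h.continuousOn_symm.comp (continuous_quad _).continuousOn
      fun x hx => P.quad_mem_target hfin (subset_closure hx)
  -- The field `conj` applies only where the image under $f$ is already known to be in the domain of
  -- $h$. This open set $T$ contains the fixed point; it is also relatively closed, since the
  -- relation passes to limits and its right side lies in the domain of $h$. So $T$ is all of $D$.
  set T := D ∩ (fun x => F.f (P.h.symm x)) ⁻¹' P.h.source with hT
  have hTo : IsOpen T := hc1.isOpen_inter_preimage hDo P.h.open_source
  have heq : ∀ x ∈ T, F.f (P.h.symm x) = P.h.symm (quad P.c x) := by
    rintro x ⟨hxD, hxs⟩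
    have h1 := P.conj (P.h.symm x) (P.h.map_target (hDt hxD)) hxs
    rw [P.h.right_inv (hDt hxD)] at h1
    rw [quad_apply, ← h1, P.h.left_inv hxs]
  have hcl : ∀ x ∈ closure T ∩ D, F.f (P.h.symm x) = P.h.symm (quad P.c x) := by
    rintro x ⟨hxT, hxD⟩
    have : (𝓝[T] x).NeBot := mem_closure_iff_nhdsWithin_neBot.mp hxT
    have t1 := (hc1.continuousAt (hDo.mem_nhds hxD)).tendsto.mono_left
      (nhdsWithin_le_nhds (s := T))
    have t2 := (hc2.continuousAt (hDo.mem_nhds hxD)).tendsto.mono_left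
      (nhdsWithin_le_nhds (s := T))
    exact tendsto_nhds_unique_of_eventuallyEq t1 t2
      (by filter_upwards [self_mem_nhdsWithin] with y hy using heq y hy)
  have hDpre : IsPreconnected D := P.isBottcher.isPreconnected_sublevel (P.poly hfin).one_lt
  have hsub : D ⊆ T := by
    refine hDpre.subset_of_closure_inter_subset hTo ?_ ?_
    · have haD : P.h P.α ∈ D := (P.poly hfin).a_mem_dom
      refine ⟨P.h P.α, haD, haD, ?_⟩
      rw [mem_preimage, P.h.left_inv P.α_mem_source, P.α_fixed]
      exact P.α_mem_source
    · rintro x hx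
      refine ⟨hx.2, ?_⟩
      rw [mem_preimage, hcl x hx]
      exact P.h.map_target (P.quad_mem_target hfin (subset_closure hx.2))
  exact heq w (hsub hw)

theorem symm_mem_dom {w : ℂ} (hw : w ∈ (P.poly hfin).dom) : P.h.symm w ∈ F.dom :=
  P.source_subset (P.h.map_target (P.dom_subset_target hfin hw))

theorem symm_inj {v w : ℂ} (hv : v ∈ P.h.target) (hw : w ∈ P.h.target) :
    P.h.symm v = P.h.symm w ↔ v = w := P.h.symm.injOn.eq_iff hv hw

theorem zero_mem_dom : (0 : ℂ) ∈ (P.poly hfin).dom := fun hb =>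
  absurd hb (P.poly hfin).zero_notMem_basin

include hfin in
/-- The conjugacy fixes the critical point. -/
theorem symm_zero : P.h.symm 0 = 0 := by
  by_contra hne
  set D := (P.poly hfin).dom with hD
  set x₀ := P.h.symm 0 with hx₀
  have h0D : (0 : ℂ) ∈ D := P.zero_mem_dom hfin
  have hDt := P.dom_subset_target hfin
  have hx₀d : x₀ ∈ F.dom := P.symm_mem_dom hfin h0D
  have hfx : F.f x₀ ≠ F.f 0 := by
    intro h
    have : x₀ ∈ F.dom ∩ F.f ⁻¹' {F.f 0} := ⟨hx₀d, h⟩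
    rw [F.fiber_crit] at this
    exact hne this
  -- If $x_0$ were not critical, its value would have a second preimage $x_1$. Values near it have
  -- one preimage near $x_1$ and, from $\pm w$, two near $x_0$: three in a fiber of degree two.
  obtain ⟨x₁, hx₁, hx₁₀⟩ : ∃ x₁ ∈ F.dom ∩ F.f ⁻¹' {F.f x₀}, x₁ ≠ x₀ := by
    apply exists_ne_of_one_lt_ncard
    rw [F.fiber _ (F.mapsTo hx₀d) hfx]
    norm_num
  obtain ⟨N₀, N₁, hN₀, hN₁, hxN₀, hxN₁, hdisj⟩ := t2_separation hx₁₀.symm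
  have himg : F.f '' (N₁ ∩ F.dom) ∈ 𝓝 (F.f x₀) := by
    have h1 := F.nhds_le_map hx₁.1 (image_mem_map (inter_mem (hN₁.mem_nhds hxN₁)
      (F.isOpen_dom.mem_nhds hx₁.1)))
    rwa [show F.f x₁ = F.f x₀ from hx₁.2] at h1
  have hcs : ContinuousAt P.h.symm 0 := P.h.continuousAt_symm (hDt h0D)
  have hcf : ContinuousAt (fun w => F.f (P.h.symm w)) 0 :=
    ContinuousAt.comp (f := P.h.symm)
      (F.holo.continuousOn.continuousAt (F.isOpen_dom.mem_nhds hx₀d)) hcs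
  have hevD : ∀ᶠ w in 𝓝 (0 : ℂ), w ∈ D := (P.poly hfin).isOpen_dom.mem_nhds h0D
  have hevN : ∀ᶠ w in 𝓝 (0 : ℂ), P.h.symm w ∈ N₀ := hcs.eventually (hN₀.mem_nhds hxN₀)
  have hneg : Tendsto (fun w : ℂ => -w) (𝓝 0) (𝓝 0) := by
    simpa using (continuous_neg (G := ℂ)).tendsto 0
  have hev1 : ∀ᶠ w in 𝓝 (0 : ℂ), F.f (P.h.symm w) ∈ F.f '' (N₁ ∩ F.dom) := hcf.eventually himg
  have hev2 : ∀ᶠ w in 𝓝 (0 : ℂ), F.f (P.h.symm w) ≠ F.f 0 := hcf.eventually_ne hfx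
  obtain ⟨w, ⟨hwD, hwN, hwD', hwN', ⟨y, ⟨hyN, hyd⟩, hy⟩, hw2⟩, hw0⟩ :=
    (((hevD.and (hevN.and ((hneg.eventually hevD).and ((hneg.eventually hevN).and
      (hev1.and hev2))))).filter_mono nhdsWithin_le_nhds).and
      (self_mem_nhdsWithin (a := (0 : ℂ)) (s := {0}ᶜ))).exists
  have hwd := P.symm_mem_dom hfin hwD
  have hwd' := P.symm_mem_dom hfin hwD'
  have hne1 : P.h.symm w ≠ P.h.symm (-w) := by
    rw [Ne, P.symm_inj (hDt hwD) (hDt hwD'), self_eq_neg]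
    exact hw0
  have hsub : ({P.h.symm w, P.h.symm (-w), y} : Set ℂ) ⊆
      F.dom ∩ F.f ⁻¹' {F.f (P.h.symm w)} := by
    rintro v (rfl | rfl | rfl)
    · exact ⟨hwd, rfl⟩
    · refine ⟨hwd', ?_⟩
      rw [mem_preimage, mem_singleton_iff, P.f_symm hfin hwD, P.f_symm hfin hwD', quad_neg]
    · exact ⟨hyd, hy⟩
  have h3 := ncard_le_ncard hsub (F.finite_fiber (F.mapsTo hwd))
  rw [F.fiber _ (F.mapsTo hwd) hw2] at h3
  have hy1 : P.h.symm w ≠ y := fun h => disjoint_left.mp hdisj hwN (h ▸ hyN)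
  have hy2 : P.h.symm (-w) ≠ y := fun h => disjoint_left.mp hdisj hwN' (h ▸ hyN)
  have h4 : ({P.h.symm w, P.h.symm (-w), y} : Set ℂ).ncard = 3 := by
    rw [ncard_eq_three]
    exact ⟨_, _, _, hne1, hy1, hy2, rfl⟩
  omega

/-- No preimage under $f$ is missed: the points of $\pm w$ transferred to $f$ are distinct and
exhaust a fiber of two points, and the critical fiber is $\{0\}$. -/
theorem preimage_image_symm {S : Set ℂ} (hS : S ⊆ (P.poly hfin).dom) :
    F.dom ∩ F.f ⁻¹' (P.h.symm '' S) = P.h.symm '' (quad P.c ⁻¹' S) := by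
  have hDt := P.dom_subset_target hfin
  have hpre : ∀ w, quad P.c w ∈ S → w ∈ (P.poly hfin).dom := fun w hw =>
    (P.poly hfin).mem_dom_of_quad_mem (hS hw)
  apply Subset.antisymm
  · rintro z ⟨hz, v, hv, hvz⟩
    have hf0 : F.f 0 = P.h.symm P.c := by
      have h1 := P.f_symm hfin (P.zero_mem_dom hfin)
      rw [P.symm_zero hfin] at h1
      rw [h1]
      simp [quad_apply]
    obtain ⟨w, rfl⟩ := exists_quad_eq P.c v
    have hwD := hpre w hv
    have hwD' : -w ∈ (P.poly hfin).dom := hpre (-w) (by rwa [quad_neg])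
    have hwf : P.h.symm w ∈ F.dom ∩ F.f ⁻¹' {F.f z} :=
      ⟨P.symm_mem_dom hfin hwD, by rw [mem_preimage, mem_singleton_iff, P.f_symm hfin hwD, hvz]⟩
    have hwf' : P.h.symm (-w) ∈ F.dom ∩ F.f ⁻¹' {F.f z} :=
      ⟨P.symm_mem_dom hfin hwD',
        by rw [mem_preimage, mem_singleton_iff, P.f_symm hfin hwD', quad_neg, hvz]⟩
    have hzf : z ∈ F.dom ∩ F.f ⁻¹' {F.f z} := ⟨hz, rfl⟩
    by_cases hzc : F.f z = F.f 0
    · rw [hzc, F.fiber_crit] at hzf hwf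
      exact ⟨w, hv, by rw [mem_singleton_iff.mp hzf, mem_singleton_iff.mp hwf]⟩
    · have hw0 : w ≠ 0 := by
        rintro rfl
        apply hzc
        rw [hf0, ← hvz]
        simp [quad_apply]
      have hne : P.h.symm w ≠ P.h.symm (-w) := by
        rw [Ne, P.symm_inj (hDt hwD) (hDt hwD'), self_eq_neg]
        exact hw0
      have hsub : ({P.h.symm w, P.h.symm (-w)} : Set ℂ) ⊆ F.dom ∩ F.f ⁻¹' {F.f z} := by
        rintro _ (rfl | rfl)
        · exact hwf
        · exact hwf'
      have heq := eq_of_subset_of_ncard_le hsub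
        (by rw [F.fiber _ (F.mapsTo hz) hzc, ncard_pair hne]) (F.finite_fiber (F.mapsTo hz))
      rw [← heq] at hzf
      rcases hzf with h | h
      · exact ⟨w, hv, h.symm⟩
      · exact ⟨-w, by rwa [mem_preimage, quad_neg], h.symm⟩
  · rintro _ ⟨w, hw, rfl⟩
    have hwD := hpre w hw
    exact ⟨P.symm_mem_dom hfin hwD, by rw [mem_preimage, P.f_symm hfin hwD]; exact ⟨_, hw, rfl⟩⟩

theorem iterPreimage_image_symm {S : Set ℂ} (hS : S ⊆ (P.poly hfin).dom) (n : ℕ) :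
    F.iterPreimage n (P.h.symm '' S) = P.h.symm '' ((quad P.c)^[n] ⁻¹' S) := by
  induction n with
  | zero =>
    ext z
    simp [QuadraticLikeMap.iterPreimage]
  | succ n ih =>
    ext z
    have h : (quad P.c)^[n] ⁻¹' S ⊆ (P.poly hfin).dom :=
      (P.poly hfin).preimage_iterate_subset_dom hS n
    rw [F.mem_iterPreimage_succ, ih, P.preimage_image_symm hfin h]
    rfl

theorem iterate_symm {k : ℕ} {w : ℂ} (hw : ∀ j < k, (quad P.c)^[j] w ∈ (P.poly hfin).dom) :
    F.f^[k] (P.h.symm w) = P.h.symm ((quad P.c)^[k] w) := by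
  induction k with
  | zero => rfl
  | succ k ih =>
    rw [Function.iterate_succ_apply', ih fun j hj => hw j (by omega),
      P.f_symm hfin (hw k (by omega)), Function.iterate_succ_apply']

theorem iterate_zero_mem_dom (k : ℕ) : (quad P.c)^[k] 0 ∈ (P.poly hfin).dom := fun hb =>
  absurd ((quad_iterate_mem_quadBasin_iff k).mp hb) (P.poly hfin).zero_notMem_basin

include hfin in
theorem iterate_zero (k : ℕ) : F.f^[k] 0 = P.h.symm ((quad P.c)^[k] 0) := by
  rw [← P.iterate_symm hfin fun j _ => P.iterate_zero_mem_dom hfin j, P.symm_zero hfin]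

/-- The closed puzzle piece of depth `n` of `F` which corresponds to the piece of the polynomial
around `w`. -/
noncomputable def closedPiece (n : ℕ) (w : ℂ) : Set ℂ :=
  P.h.symm '' closure ((P.poly hfin).piece n w)

theorem closure_piece_subset_target (n : ℕ) (w : ℂ) :
    closure ((P.poly hfin).piece n w) ⊆ P.h.target :=
  (closure_mono ((P.poly hfin).piece_subset_dom n w)).trans (P.closure_dom_subset_target hfin)

/-- Regularity of pieces enters here: definitions by interiors of closed pieces can be read with
open pieces of the polynomial. -/
theorem interior_closedPiece (n : ℕ) (w : ℂ) :
    interior (P.closedPiece hfin n w) = P.h.symm '' (P.poly hfin).piece n w := by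
  rw [closedPiece, P.h.interior_image_symm (P.closure_piece_subset_target hfin n w),
    (P.poly hfin).interior_closure_piece]

theorem closure_image_piece (n : ℕ) (w : ℂ) :
    closure (P.h.symm '' (P.poly hfin).piece n w) = P.closedPiece hfin n w :=
  P.h.closure_image_symm ((P.poly hfin).isCompact_closure_piece n w)
    (P.closure_piece_subset_target hfin n w)

theorem symm_mem_interior_iff {n : ℕ} {v w : ℂ} (hv : v ∈ P.h.target) :
    P.h.symm v ∈ interior (P.closedPiece hfin n w) ↔ v ∈ (P.poly hfin).piece n w := by
  rw [interior_closedPiece]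
  exact P.h.symm.injOn.mem_image_iff (subset_closure.trans (P.closure_piece_subset_target hfin n w)) hv

theorem symm_mem_closedPiece_iff {n : ℕ} {v w : ℂ} (hv : v ∈ P.h.target) :
    P.h.symm v ∈ P.closedPiece hfin n w ↔ v ∈ closure ((P.poly hfin).piece n w) :=
  P.h.symm.injOn.mem_image_iff (P.closure_piece_subset_target hfin n w) hv

theorem domain_diff_rays : P.equipotentialDomain \ P.rays = P.h.symm '' (P.poly hfin).level 0 := by
  ext z
  constructor
  · rintro ⟨⟨hzs, hz⟩, hzr⟩
    refine ⟨P.h z, ⟨hz, ?_⟩, P.h.left_inv hzs⟩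
    rintro (⟨u, hu, hzu⟩ | hza)
    · exact hzr (Or.inl ⟨hzs, u, hu, hzu⟩)
    · exact hzr (Or.inr (P.h.injOn hzs P.α_mem_source hza))
  · rintro ⟨w, ⟨hwD, hwc⟩, rfl⟩
    change w ∈ (P.poly hfin).dom at hwD
    change w ∉ (P.poly hfin).cut (P.poly hfin).angles at hwc
    have hwt := P.dom_subset_target hfin hwD
    refine ⟨⟨P.h.map_target hwt, ?_⟩, ?_⟩
    · rw [P.h.right_inv hwt]
      exact hwD
    · rintro (⟨_, u, hu, hwu⟩ | hwa)
      · rw [P.h.right_inv hwt] at hwu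
        exact hwc (Or.inl ⟨u, hu, hwu⟩)
      · refine hwc (Or.inr ?_)
        rw [mem_singleton_iff, ← P.h.right_inv hwt, mem_singleton_iff.mp hwa]
        rfl

theorem isPieceZero_iff {Y : Set ℂ} :
    P.IsPieceZero Y ↔ ∃ w ∈ (P.poly hfin).level 0, Y = P.closedPiece hfin 0 w := by
  have hsub : (P.poly hfin).level 0 ⊆ P.h.target :=
    ((P.poly hfin).level_subset_dom 0).trans (P.dom_subset_target hfin)
  have key : ∀ w ∈ (P.poly hfin).level 0,
      closure (connectedComponentIn (P.h.symm '' (P.poly hfin).level 0) (P.h.symm w)) =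
      P.closedPiece hfin 0 w := by
    intro w hw
    rw [P.h.connectedComponentIn_image_symm hsub hw]
    exact P.closure_image_piece hfin 0 w
  rw [IsPieceZero, P.domain_diff_rays hfin]
  constructor
  · rintro ⟨_, ⟨w, hw, rfl⟩, rfl⟩
    exact ⟨w, hw, key w hw⟩
  · rintro ⟨w, hw, rfl⟩
    exact ⟨_, mem_image_of_mem _ hw, (key w hw).symm⟩

theorem closure_component_preimage {d n : ℕ} {w w₀ : ℂ}
    (hw : (quad P.c)^[n] w ∈ (P.poly hfin).piece d w₀) :
    closure (connectedComponentIn (P.h.symm '' ((quad P.c)^[n] ⁻¹' (P.poly hfin).piece d w₀))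
      (P.h.symm w)) = P.closedPiece hfin (d + n) w := by
  have hsub : (quad P.c)^[n] ⁻¹' (P.poly hfin).piece d w₀ ⊆ P.h.target :=
    ((P.poly hfin).preimage_iterate_subset_dom
      ((P.poly hfin).piece_subset_dom d w₀) n).trans (P.dom_subset_target hfin)
  rw [P.h.connectedComponentIn_image_symm hsub hw]
  have h := (P.poly hfin).connectedComponentIn_preimage_piece hw
  change connectedComponentIn ((quad P.c)^[n] ⁻¹' (P.poly hfin).piece d w₀) w = _ at h
  rw [h, P.closure_image_piece hfin]

theorem isPiece_iff {n : ℕ} {Q : Set ℂ} :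
    P.IsPiece n Q ↔ ∃ w ∈ (P.poly hfin).level n, Q = P.closedPiece hfin n w := by
  constructor
  · rintro ⟨Y, hY, z, hz, rfl⟩
    obtain ⟨w₀, hw₀, rfl⟩ := (P.isPieceZero_iff hfin).mp hY
    rw [P.interior_closedPiece, P.iterPreimage_image_symm hfin
      ((P.poly hfin).piece_subset_dom 0 w₀)] at hz ⊢
    obtain ⟨w, hw, rfl⟩ := hz
    have h := P.closure_component_preimage hfin hw
    rw [zero_add] at h
    refine ⟨w, ?_, h⟩
    have h1 := (P.poly hfin).quad_iterate_mem_level_iff.mp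
      ((P.poly hfin).mem_level_of_mem_piece hw)
    rwa [zero_add] at h1
  · rintro ⟨w, hw, rfl⟩
    have h0 : (quad P.c)^[n] w ∈ (P.poly hfin).level 0 := by
      refine (P.poly hfin).quad_iterate_mem_level_iff.mpr ?_
      rwa [zero_add]
    have h1 := (P.poly hfin).mem_piece_self h0
    refine ⟨_, (P.isPieceZero_iff hfin).mpr ⟨_, h0, rfl⟩, P.h.symm w, ?_, ?_⟩
    · rw [P.interior_closedPiece, P.iterPreimage_image_symm hfin
        ((P.poly hfin).piece_subset_dom 0 _)]
      exact mem_image_of_mem _ h1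
    · rw [P.interior_closedPiece, P.iterPreimage_image_symm hfin
        ((P.poly hfin).piece_subset_dom 0 _)]
      have h := P.closure_component_preimage hfin h1
      rw [zero_add] at h
      exact h.symm

/-- Each step takes a component of the preimage of an open piece, which is an open piece one level
deeper; $k$ steps add $k$ to the depth. -/
theorem pullback_closedPiece {d : ℕ} {w₀ : ℂ} (k : ℕ) {w : ℂ}
    (hw : (quad P.c)^[k] w ∈ (P.poly hfin).piece d w₀) :
    F.pullback (P.closedPiece hfin d w₀) k (P.h.symm w) = P.closedPiece hfin (d + k) w := by
  induction k generalizing w with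
  | zero =>
    have h := (P.poly hfin).piece_eq hw
    change (P.poly hfin).piece d w = _ at h
    rw [QuadraticLikeMap.pullback, closedPiece, ← h]
    rfl
  | succ k ih =>
    have hwD : w ∈ (P.poly hfin).dom :=
      (P.poly hfin).preimage_iterate_subset_dom ((P.poly hfin).piece_subset_dom d w₀) (k + 1) hw
    rw [QuadraticLikeMap.pullback, P.f_symm hfin hwD, ih hw, P.interior_closedPiece,
      P.preimage_image_symm hfin ((P.poly hfin).piece_subset_dom _ _)]
    have h1 : quad P.c w ∈ (P.poly hfin).level (d + k) :=
      (P.poly hfin).quad_iterate_mem_level_iff.mp ((P.poly hfin).mem_level_of_mem_piece hw)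
    exact P.closure_component_preimage hfin (n := 1) (d := d + k) ((P.poly hfin).mem_piece_self h1)

end YoccozPuzzle

/-! ### The principal nest and its cascades -/

namespace YoccozPuzzle

variable {F : QuadraticLikeMap} (P : YoccozPuzzle F)

/-- The critical point can escape only if finitely many rays land at `α`. -/
theorem EscapesThrough.finite_landingAngles {P : YoccozPuzzle F} {t : ℕ} {Z : Set ℂ}
    (hZ : P.EscapesThrough t Z) : (landingAngles P.c (P.h P.α)).Finite := by
  by_contra hinf
  -- For an infinite set `ncard` is $0$, so the escape time $tp$ would be $0$ and $0$ itself would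
  -- lie in $\operatorname{int}Z$, which is excluded.
  have hp : P.p = 0 := Set.Infinite.ncard hinf
  have h1 := hZ.2.1
  rw [hp, mul_zero] at h1
  exact hZ.1.2.1 h1

variable (hfin : (landingAngles P.c (P.h P.α)).Finite)

theorem iterate_zero_mem_interior_iff {k d : ℕ} {w : ℂ} :
    F.f^[k] 0 ∈ interior (P.closedPiece hfin d w) ↔ (quad P.c)^[k] 0 ∈ (P.poly hfin).piece d w := by
  rw [P.iterate_zero hfin, P.symm_mem_interior_iff hfin
    (P.dom_subset_target hfin (P.iterate_zero_mem_dom hfin k))]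

theorem returnTime_spec {d : ℕ} (hret : F.CriticalReturns (P.closedPiece hfin d 0)) :
    0 < F.returnTime (P.closedPiece hfin d 0) ∧
      (quad P.c)^[F.returnTime (P.closedPiece hfin d 0)] 0 ∈ (P.poly hfin).piece d 0 ∧
      ∀ j, 0 < j → j < F.returnTime (P.closedPiece hfin d 0) →
        (quad P.c)^[j] 0 ∉ (P.poly hfin).piece d 0 := by
  have h := Nat.sInf_mem hret
  refine ⟨h.1, (P.iterate_zero_mem_interior_iff hfin).mp h.2, fun j hj hjr hmem => ?_⟩
  exact Nat.notMem_of_lt_sInf hjr ⟨hj, (P.iterate_zero_mem_interior_iff hfin).mpr hmem⟩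

theorem nest_succ_eq {W : Set ℂ} {n d : ℕ} (hn : F.nest W n = P.closedPiece hfin d 0)
    (hret : F.CriticalReturns (F.nest W n)) :
    F.nest W (n + 1) = P.closedPiece hfin (d + F.returnTime (F.nest W n)) 0 := by
  rw [hn] at hret
  have h := P.pullback_closedPiece hfin _ (P.returnTime_spec hfin hret).2.1
  rw [P.symm_zero hfin] at h
  rw [QuadraticLikeMap.nest, hn, h]

theorem exists_nest_eq {W : Set ℂ} {d₀ : ℕ} (hW : W = P.closedPiece hfin d₀ 0) {n : ℕ}
    (hret : ∀ k < n, F.CriticalReturns (F.nest W k)) :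
    ∃ d, F.nest W n = P.closedPiece hfin d 0 := by
  induction n with
  | zero => exact ⟨d₀, hW⟩
  | succ n ih =>
    obtain ⟨d, hd⟩ := ih fun k hk => hret k (by omega)
    exact ⟨_, P.nest_succ_eq hfin hd (hret n (by omega))⟩

/-- The pieces of a central cascade are the pull-backs of the first one by the iterates of one
return map. -/
theorem exists_cascade {W : Set ℂ} {d₀ : ℕ} (hW : W = P.closedPiece hfin d₀ 0) {m N : ℕ}
    (hC : F.IsCentralCascade W m N) :
    ∃ d r, 0 < r ∧ F.nest W m = P.closedPiece hfin d 0 ∧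
      F.nest W (m + N) = P.closedPiece hfin (d + N * r) 0 ∧
      (quad P.c)^[r] 0 ∈ (P.poly hfin).piece (d + (N - 1) * r) 0 ∧
      ∀ j, 0 < j → j < r → (quad P.c)^[j] 0 ∉ (P.poly hfin).piece d 0 := by
  obtain ⟨hN, hret, hcent, -⟩ := hC
  obtain ⟨d, hd⟩ := P.exists_nest_eq hfin hW fun k (hk : k < m) => hret k (by omega)
  have hm := hret m (by omega)
  set r := F.returnTime (F.nest W m) with hr
  rw [hd] at hm hr
  obtain ⟨hr0, hr1, hr2⟩ := P.returnTime_spec hfin hm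
  rw [← hr] at hr0 hr1 hr2
  -- By induction along the cascade the return time stays equal to $r$ and each level adds $r$ to
  -- the depth.
  have key : ∀ i, i < N → F.nest W (m + i) = P.closedPiece hfin (d + i * r) 0 ∧
      F.returnTime (F.nest W (m + i)) = r ∧
      (quad P.c)^[r] 0 ∈ (P.poly hfin).piece (d + i * r) 0 := by
    intro i
    induction i with
    | zero =>
      intro _
      refine ⟨by simpa using hd, by rw [hr, add_zero, hd], by simpa using hr1⟩
    | succ i ih =>
      intro hi
      obtain ⟨h1, h2, h3⟩ := ih (by omega)
      have e : d + i * r + r = d + (i + 1) * r := by ring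
      have h4 : F.nest W (m + (i + 1)) = P.closedPiece hfin (d + (i + 1) * r) 0 := by
        have := P.nest_succ_eq hfin h1 (hret (m + i) (by omega))
        rwa [h2, e] at this
      have h5 := hcent (m + i) (by omega) (by omega)
      rw [QuadraticLikeMap.returnValue, h2, add_assoc, h4, P.iterate_zero hfin,
        P.symm_mem_closedPiece_iff hfin
          (P.dom_subset_target hfin (P.iterate_zero_mem_dom hfin r))] at h5
      have h6 := hret (m + (i + 1)) (by omega)
      rw [h4] at h6
      obtain ⟨hk0, hk1, hk2⟩ := P.returnTime_spec hfin h6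
      set k := F.returnTime (P.closedPiece hfin (d + (i + 1) * r) 0) with hk
      have hanti : (P.poly hfin).piece (d + (i + 1) * r) 0 ⊆ (P.poly hfin).piece d 0 :=
        (P.poly hfin).piece_anti 0 (Nat.le_add_right _ _)
      -- A return to a smaller piece is also a return to $V^m$.
      have hkr : r ≤ k := by
        by_contra! hlt
        exact hr2 k hk0 hlt (hanti hk1)
      -- Centrality only puts $f^r(0)$ in the closed piece. As $f^k(0)$ with $k\ge r$ is in an open
      -- piece, $f^r(0)$ is not on the boundary.
      have h7 : (quad P.c)^[r] 0 ∈ (P.poly hfin).piece (d + (i + 1) * r) 0 := by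
        refine (P.poly hfin).mem_piece_of_iterate_mem_level (k := k - r) h5 ?_
        change (quad P.c)^[k - r] _ ∈ _
        rw [← Function.iterate_add_apply, Nat.sub_add_cancel hkr]
        exact (P.poly hfin).mem_level_of_mem_piece hk1
      refine ⟨h4, ?_, h7⟩
      rw [h4, ← hk]
      refine le_antisymm ?_ hkr
      by_contra! hlt
      exact hk2 r hr0 hlt h7
  obtain ⟨h1, h2, h3⟩ := key (N - 1) (by omega)
  refine ⟨d, r, hr0, hd, ?_, h3, hr2⟩
  -- The return to level $m+N-1$ also takes time $r$, so one more pull-back gives $V^{m+N}$ at depth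
  -- $d+Nr$.
  have h4 := P.nest_succ_eq hfin h1 (hret _ (by omega))
  rw [h2] at h4
  have e1 : m + (N - 1) + 1 = m + N := by omega
  have e2 : d + (N - 1) * r + r = d + N * r := by
    obtain ⟨N', rfl⟩ := Nat.exists_eq_add_of_le' hN
    simp only [Nat.add_sub_cancel]
    ring
  rwa [e1, e2] at h4

/-- Transfer of univalence from the polynomial to the quadratic-like map. -/
theorem mapsUnivalently_closedPiece {d l : ℕ} {v w : ℂ}
    (h1 : BijOn (quad P.c)^[l] (closure ((P.poly hfin).piece (d + l) w))
      (closure ((P.poly hfin).piece d v)))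
    (h2 : BijOn (quad P.c)^[l] ((P.poly hfin).piece (d + l) w) ((P.poly hfin).piece d v)) :
    F.MapsUnivalently l (P.closedPiece hfin (d + l) w) (P.closedPiece hfin d v) := by
  have hdom : ∀ j < l, ∀ x ∈ closure ((P.poly hfin).piece (d + l) w),
      (quad P.c)^[j] x ∈ (P.poly hfin).dom := fun j hj x hx =>
    (P.poly hfin).iterate_mem_dom_of_mem_closure hj hx
  have hbij : ∀ {S T : Set ℂ}, S ⊆ closure ((P.poly hfin).piece (d + l) w) → T ⊆ P.h.target →
      BijOn (quad P.c)^[l] S T → BijOn F.f^[l] (P.h.symm '' S) (P.h.symm '' T) := by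
    intro S T hS hT hST
    have hSt : S ⊆ P.h.target := hS.trans (P.closure_piece_subset_target hfin _ _)
    have heq : EqOn (F.f^[l] ∘ P.h.symm) (P.h.symm ∘ (quad P.c)^[l]) S := fun x hx =>
      P.iterate_symm hfin fun j hj => hdom j hj x (hS hx)
    have hT' : BijOn P.h.symm T (P.h.symm '' T) := (P.h.symm.injOn.mono hT).bijOn_image
    have hc : BijOn (F.f^[l] ∘ P.h.symm) S (P.h.symm '' T) := (hT'.comp hST).congr heq.symm
    refine ⟨?_, ?_, ?_⟩
    · rintro _ ⟨x, hx, rfl⟩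
      exact hc.mapsTo hx
    · rintro _ ⟨x, hx, rfl⟩ _ ⟨y, hy, rfl⟩ hxy
      rw [hc.injOn hx hy hxy]
    · intro y hy
      obtain ⟨x, hx, hxy⟩ := hc.surjOn hy
      exact ⟨_, mem_image_of_mem _ hx, hxy⟩
  have hmaps : ∀ k < l, MapsTo F.f^[k] (P.closedPiece hfin (d + l) w) F.dom := by
    rintro k hk _ ⟨x, hx, rfl⟩
    rw [P.iterate_symm hfin fun j hj => hdom j (hj.trans hk) x hx]
    exact P.symm_mem_dom hfin (hdom k hk x hx)
  refine ⟨hmaps, hbij subset_rfl (P.closure_piece_subset_target hfin _ _) h1, ?_,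
    F.differentiableOn_iterate l fun k hk => (hmaps k hk).mono_left interior_subset⟩
  rw [P.interior_closedPiece, P.interior_closedPiece]
  exact hbij subset_closure (subset_closure.trans (P.closure_piece_subset_target hfin _ _)) h2

end YoccozPuzzle

/-! ### The univalent pull-back -/

theorem lemma3p7 (F : QuadraticLikeMap) (hJ : IsConnected F.juliaSet)
    (hrep : F.FixedPointsRepelling) (P : YoccozPuzzle F)
    (t : ℕ) (Z : Set ℂ) (hZ : P.EscapesThrough t Z)
    (m N : ℕ) (hC : P.IsCentralCascade t Z m N)
    (z : ℂ)
    (hz : ∃ k, z ∈ F.iterPreimage k (interior (P.principalNest t Z (m + N))))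
    (l : ℕ) (hl : IsLeast {k | z ∈ F.iterPreimage k (P.principalNest t Z (m + N))} l) :
    ∃ (n : ℕ) (Ω : Set ℂ), P.IsPiece n Ω ∧ z ∈ Ω ∧
      F.MapsUnivalently l Ω (P.principalNest t Z m) := by
  have hfin := hZ.finite_landingAngles
  set X := P.poly hfin
  obtain ⟨w₀, -, hw₀⟩ := (P.isPiece_iff hfin).mp hZ.1.1
  have hW : F.pullback Z (t * P.p) 0 = P.closedPiece hfin (1 + t * P.p) 0 := by
    have h1 := hZ.2.1
    rw [hw₀, P.iterate_zero_mem_interior_iff hfin] at h1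
    have h2 := P.pullback_closedPiece hfin _ h1
    rwa [P.symm_zero hfin, ← hw₀] at h2
  obtain ⟨d, r, hr, hm, hmN, hret, hfirst⟩ := P.exists_cascade hfin hW hC
  change P.principalNest t Z m = _ at hm
  change P.principalNest t Z (m + N) = _ at hmN
  rw [hmN] at hz hl
  rw [hm]
  obtain ⟨k, hk⟩ := hz
  have hlk : l ≤ k := hl.2 (F.iterPreimage_mono interior_subset hk)
  rw [P.interior_closedPiece, P.iterPreimage_image_symm hfin (X.piece_subset_dom _ _)] at hk
  obtain ⟨w, hwk, rfl⟩ := hk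
  have hdom : ∀ j ≤ k, (quad P.c)^[j] w ∈ X.dom := by
    intro j hj
    refine X.preimage_iterate_subset_dom (X.piece_subset_dom (d + N * r) 0) (k - j) ?_
    change (quad P.c)^[k - j] ((quad P.c)^[j] w) ∈ X.piece (d + N * r) 0
    rwa [← Function.iterate_add_apply, Nat.sub_add_cancel hj]
  -- The moment $l$ is a visit of the closed piece. Because the orbit is in the open piece at the
  -- time $k\ge l$, this visit is to the interior as well.
  have hwl : (quad P.c)^[l] w ∈ X.piece (d + N * r) 0 := by
    have h1 := hl.1.2
    rw [P.iterate_symm hfin fun j hj => hdom j (by omega),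
      P.symm_mem_closedPiece_iff hfin (P.dom_subset_target hfin (hdom l hlk))] at h1
    refine X.mem_piece_of_iterate_mem_level (k := k - l) h1 ?_
    change (quad P.c)^[k - l] _ ∈ _
    rw [← Function.iterate_add_apply, Nat.sub_add_cancel hlk]
    exact X.mem_level_of_mem_piece hwk
  have hmin : ∀ j < l, (quad P.c)^[j] w ∉ X.piece (d + N * r) 0 := by
    intro j hj hmem
    refine absurd (hl.2 (F.iterPreimage_mono interior_subset ?_)) (not_le.mpr hj)
    rw [P.interior_closedPiece, P.iterPreimage_image_symm hfin (X.piece_subset_dom _ _)]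
    exact mem_image_of_mem _ hmem
  have hlevel : w ∈ X.level (d + l) := by
    refine X.quad_iterate_mem_level_iff.mp (X.mem_level_of_mem_piece (w := 0) ?_)
    exact X.piece_anti 0 (Nat.le_add_right d (N * r)) hwl
  obtain ⟨hb1, hb2⟩ := X.cascade_bijOn hr hC.1 hret hfirst hwl hmin
  exact ⟨d + l, _, (P.isPiece_iff hfin).mpr ⟨w, hlevel, rfl⟩,
    mem_image_of_mem _ (subset_closure (X.mem_piece_self hlevel)),
    P.mapsUnivalently_closedPiece hfin hb1 hb2⟩
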